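/- \textbf{Setting.} Fix integers $0\le n_0<n_1$, a real $\kappa>0$ and an integer $M_0\ge 1$. Transactions arrive one at a time, and each one \emph{approves} (is attached to, by directed edges) an ordered pair of two earlier transactions, possibly equal. The \emph{window} is the directed acyclic multigraph induced by the last $n_1$ transactions, listed in order of attachment. The $n_0$ newest transactions are not seen by an incoming one, and $\mathcal G_{n_1}$ is the finite set of all possible windows. An \emph{attachment strategy} assigns to every window a probability measure on the ordered pairs of seen vertices of the window (the pair to which the new transaction is attached), which depends only on the subgraph induced by the seen vertices; strategies are thus points of some $\mathbb R^d$. A \emph{default strategy} and, for every window, the law of the vertex at which the \emph{default tip-selecting walk} stops are fixed. The space $\mathcal Q$ of admissible strategies is the convex hull of a compact set of attachment strategies. There are $N\ge1$ selfish nodes, using strategies $\mathcal S_1,\dots,\mathcal S_N$, and default nodes, which use the default strategy. Independently of the past, each transaction is issued by a default node with probability $\frac{\kappa}{\kappa+1}$ and by the $k$th selfish node with probability $\frac1{(\kappa+1)N}$, $k=1,\dots,N$, and it is attached according to the strategy of its issuer applied to the current window. For a transaction $v$, let $W(v)$ be the number of those $k\in\{1,\dots,M_0\}$ for which a default tip-selecting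 walk, run on the window just before the $k$th transaction after $v$ is attached, stops at a vertex from which no directed path leads to $v$. If $v^{(k)}_1,v^{(k)}_2,\dots$ are the transactions issued by the $k$th selfish node, its \emph{mean cost} is the almost sure limit $$\mathfrak C^{(k)}(\mathcal S_1,\dots,\mathcal S_N)=M_0^{-1}\lim_{n\to\infty}\frac{W(v^{(k)}_1)+\dots+W(v^{(k)}_n)}{n}.$$ For $\varepsilon\ge0$, a vector $(\mathcal S_1,\dots,\mathcal S_N)\in\mathcal Q^N$ is an \emph{$\varepsilon$-equilibrium} if for all $k$ and all $\mathcal S'\in\mathcal Q$ $$\mathfrak C^{(k)}(\mathcal S_1,\dots,\mathcal S_N)\le\mathfrak C^{(k)}(\mathcal S_1,\dots,\mathcal S_{k-1},\mathcal S',\mathcal S_{k+1},\dots,\mathcal S_N)+\varepsilon,$$ and a \emph{Nash equilibrium} if this holds with $\varepsilon=0$. \textbf{Theorem.} Assume that the Markov chain on $\mathcal G_{n_1}$ formed by the successive windows when all nodes use the default strategy is irreducible and aperiodic. Then for all $N\ge1$, all attachment strategies $\mathcal S_1,\dots,\mathcal S_N$ and all $k$, the limit defining $\mathfrak C^{(k)}(\mathcal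 S_1,\dots,\mathcal S_N)$ exists almost surely and is a constant that does not depend on the initial window. Moreover, for every $\varepsilon>0$ there is $N_0$, depending only on $\varepsilon$ and on the fixed data above other than $\mathcal Q$, such that for every $\mathcal Q$, every $N\ge N_0$ (with $N\ge 1$) and every Nash equilibrium $(\mathcal S_1,\dots,\mathcal S_N)\in\mathcal Q^N$, the symmetric vector $(\mathcal S,\dots,\mathcal S)$ with $$\mathcal S=\frac1N\sum_{k=1}^N\mathcal S_k$$ is an $\varepsilon$-equilibrium, and under it the cost of every selfish node equals the average cost in the original equilibrium: $$\mathfrak C^{(j)}(\mathcal S,\dots,\mathcal S)=\frac1N\sum_{k=1}^N\mathfrak C^{(k)}(\mathcal S_1,\dots,\mathcal S_N)\qquad(j=1,\dots,N).$$ -/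

import Mathlib

open MeasureTheory ProbabilityTheory Filter Topology

/-- The restriction of the tangle to its last `n₁` transactions, when the last `n₀` transactions
are always unseen by an incoming one. Vertices are listed by time of attachment (`0` is the oldest,
`n₁ - 1` the newest). `mult i j` is the multiplicity of the edge `i → j` ("`i` approves `j`").
A transaction approves two (possibly equal) earlier transactions, each having at least `n₀` other
ones attached between the two; an approval of a vertex that is older than the last `n₁`
transactions disappears in the restriction, so the remaining out-degree is at most two. -/
@[ext]
structure Window (n₁ n₀ : ℕ) where
  mult : Fin n₁ → Fin n₁ → ℕ
  delayed : ∀ i j, mult i j ≠ 0 → (j : ℕ) + n₀ < i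
  outdeg_le : ∀ i, ∑ j, mult i j ≤ 2

namespace Window

variable {n₁ n₀ : ℕ}

instance : Finite (Window n₁ n₀) := by
  have hle : ∀ (x : Window n₁ n₀) i j, x.mult i j < 3 := fun x i j =>
    Nat.lt_succ_of_le
      ((Finset.single_le_sum (f := x.mult i) (fun _ _ => Nat.zero_le _) (Finset.mem_univ j)).trans
        (x.outdeg_le i))
  refine Finite.of_injective
    (fun x : Window n₁ n₀ => fun i j => (⟨x.mult i j, hle x i j⟩ : Fin 3)) ?_
  intro x y h
  ext i j
  have := congrFun (congrFun h i) j
  simpa using this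

noncomputable instance : Fintype (Window n₁ n₀) := Fintype.ofFinite _

/-- Two windows have the same seen part: the sub-DAGs induced by the oldest `n₁ - n₀` of the
`n₁` vertices (all but the last `n₀` transactions) coincide. -/
def SameSeen (x y : Window n₁ n₀) : Prop :=
  ∀ i j : Fin n₁, (i : ℕ) < n₁ - n₀ → (j : ℕ) < n₁ - n₀ → x.mult i j = y.mult i j

end Window

/-- Ordered pairs of seen vertices: those at the positions `0, …, n₁ - n₀ - 1` of the window. -/
abbrev SeenPair (n₁ n₀ : ℕ) : Type := Fin (n₁ - n₀) × Fin (n₁ - n₀)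

namespace Window

variable {n₁ n₀ : ℕ}

/-- Multiplicities after a new transaction has been attached to the pair `p`: the oldest vertex
leaves the window, all the positions decrease by one, and the new vertex gets the position
`n₁ - 1`. -/
def pushMult (x : Window n₁ n₀) (p : SeenPair n₁ n₀) (i j : Fin n₁) : ℕ :=
  if hi : (i : ℕ) + 1 < n₁ then
    if hj : (j : ℕ) + 1 < n₁ then x.mult ⟨i + 1, hi⟩ ⟨j + 1, hj⟩ else 0
  else
    (if (p.1 : ℕ) = j + 1 then 1 else 0) + (if (p.2 : ℕ) = j + 1 then 1 else 0)

theorem sum_ite_pos_le (c : ℕ) :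
    ∑ j : Fin n₁, (if c = (j : ℕ) + 1 then 1 else 0) ≤ 1 := by
  rw [← Finset.card_filter, Finset.card_le_one]
  intro a ha b hb
  simp only [Finset.mem_filter, Finset.mem_univ, true_and] at ha hb
  exact Fin.ext (by omega)

/-- The window after a new transaction has been attached to the pair `p`. -/
def push (x : Window n₁ n₀) (p : SeenPair n₁ n₀) : Window n₁ n₀ where
  mult := x.pushMult p
  delayed := by
    intro i j h
    unfold pushMult at h
    split_ifs at h with hi hj h1 h2 h2
    · have := x.delayed _ _ h
      simp only at this
      omega
    all_goals first
      | (exact absurd rfl h)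
      | (have := p.1.isLt; have := p.2.isLt; have := i.isLt; omega)
  outdeg_le := by
    intro i
    unfold pushMult
    by_cases hi : (i : ℕ) + 1 < n₁
    · simp only [hi, dite_true]
      refine le_trans ?_ (x.outdeg_le ⟨i + 1, hi⟩)
      obtain ⟨m, rfl⟩ : ∃ m, n₁ = m + 1 := ⟨n₁ - 1, by omega⟩
      rw [Fin.sum_univ_castSucc, Fin.sum_univ_succ (x.mult ⟨i + 1, hi⟩)]
      simp only [Fin.val_castSucc, Fin.val_last, lt_irrefl, dite_false, add_zero]
      refine le_trans (Finset.sum_le_sum fun j _ => ?_) (Nat.le_add_left _ _)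
      have hj : (j : ℕ) + 1 < m + 1 := by omega
      rw [dif_pos hj]
      exact le_of_eq rfl
    · simp only [hi, dite_false, Finset.sum_add_distrib]
      exact add_le_add (sum_ite_pos_le _) (sum_ite_pos_le _)

end Window

/-- The attachment strategies (attachment methods), as a subset of a finite-dimensional real vector
space: to each window there corresponds a probability measure on the ordered pairs of seen
vertices, which depends on the seen part of the window only. -/
def strategies (n₁ n₀ : ℕ) : Set (Window n₁ n₀ → SeenPair n₁ n₀ → ℝ) :=
  {S | (∀ x, S x ∈ stdSimplex ℝ (SeenPair n₁ n₀)) ∧ ∀ x y, x.SameSeen y → S x = S y}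

/-- An attachment strategy. -/
abbrev Strategy (n₁ n₀ : ℕ) : Type := ↥(strategies n₁ n₀)

theorem convex_strategies (n₁ n₀ : ℕ) : Convex ℝ (strategies n₁ n₀) := by
  intro S hS S' hS' a b ha hb hab
  refine ⟨fun x => convex_stdSimplex ℝ _ (hS.1 x) (hS'.1 x) ha hb hab, fun x y h => ?_⟩
  simp [hS.2 x y h, hS'.2 x y h]

/-- The averaged strategy `(1/N) ∑ₖ Sₖ`. -/
noncomputable def averageStrategy {n₁ n₀ N : ℕ} [NeZero N] (s : Fin N → Strategy n₁ n₀) :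
    Strategy n₁ n₀ :=
  ⟨(1 / (N : ℝ)) • ∑ k, (s k : Window n₁ n₀ → SeenPair n₁ n₀ → ℝ), by
    rw [Finset.smul_sum]
    refine (convex_strategies n₁ n₀).sum_mem (fun _ _ => by positivity) ?_ (fun k _ => (s k).2)
    have : (N : ℝ) ≠ 0 := Nat.cast_ne_zero.mpr (NeZero.ne N)
    simp [this]⟩

/-- A point of the standard simplex as a probability mass function. -/
noncomputable def pmfOfSimplex {α : Type} [Fintype α] (v : α → ℝ) (hv : v ∈ stdSimplex ℝ α) :
    PMF α :=
  PMF.ofFintype (fun a => ENNReal.ofReal (v a)) (by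
    rw [← ENNReal.ofReal_sum_of_nonneg fun a _ => hv.1 a, hv.2, ENNReal.ofReal_one])

/-- The fixed data of the system. `κ` is the ratio of the numbers of default and selfish nodes,
`M₀` the number of subsequent transactions that enter into the cost, `dflt` the default attachment
strategy, and `walk x` the law of the vertex at which the default tip-selecting walk stops when the
restriction of the tangle to the last `n₁` transactions is `x` (any such law is allowed). -/
structure TangleModel (n₁ n₀ : ℕ) where
  κ : ℝ
  κ_pos : 0 < κ
  M₀ : ℕ
  M₀_pos : 0 < M₀
  dflt : Strategy n₁ n₀
  walk : Window n₁ n₀ → stdSimplex ℝ (Fin n₁)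

/-- What happens when one transaction arrives: the window just before its attachment, its issuer
(`some k` is the `k`-th selfish node, `none` is one of the default nodes), the pair of positions in
the window to which it is attached, and the position at which a default tip-selecting walk on
the same window stops. -/
structure Arrival (n₁ n₀ N : ℕ) where
  window : Window n₁ n₀
  issuer : Option (Fin N)
  pair : SeenPair n₁ n₀
  exit : Fin n₁

instance {n₁ n₀ N : ℕ} : Finite (Arrival n₁ n₀ N) :=
  Finite.of_injective (fun a => (a.window, a.issuer, a.pair, a.exit)) (by
    rintro ⟨⟩ ⟨⟩ h
    simpa using h)

instance {n₁ n₀ N : ℕ} : MeasurableSpace (Arrival n₁ n₀ N) := ⊤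

instance {n₁ n₀ N : ℕ} : DiscreteMeasurableSpace (Arrival n₁ n₀ N) := ⟨fun _ => trivial⟩

/-- A nonnegative matrix is aperiodic: the greatest common divisor of the possible return
times of every state is one. -/
def IsAperiodicMatrix {E : Type} [Fintype E] (P : Matrix E E ℝ) : Prop :=
  letI := Classical.decEq E
  ∀ x : E, ∀ d : ℕ, (∀ n : ℕ, 0 < n → 0 < (P ^ n) x x → d ∣ n) → d = 1

section Trajectories

variable {n₁ n₀ N : ℕ}

/-- Along a trajectory, vertices are labelled by natural numbers in the order of attachment: the
window before the `t`-th arrival (`t = 0, 1, …`) consists of `t, …, t + n₁ - 1`, and the transaction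
arriving then gets the label `t + n₁`. The relation says that `u`, one of the arriving transactions,
approves `w`. -/
def Approves (ω : ℕ → Arrival n₁ n₀ N) (u w : ℕ) : Prop :=
  ∃ t, u = t + n₁ ∧ (w = t + ((ω t).pair.1 : ℕ) ∨ w = t + ((ω t).pair.2 : ℕ))

/-- `u` references `w`: there is a directed path (with at least one edge) from `u` to `w`. Only
edges that start at arriving transactions matter for referencing an arriving transaction. -/
def References (ω : ℕ → Arrival n₁ n₀ N) : ℕ → ℕ → Prop :=
  Relation.TransGen (Approves ω)

open Classical in
/-- The number `W(v)`, for the transaction `v` of the `t`-th arrival: how many of the default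
tip-selecting walks at the `M₀` subsequent arrivals (each performed on the tangle just before the
arrival) stop at a vertex that does not reference `v`. -/
noncomputable def unreferencedCount (M₀ : ℕ) (ω : ℕ → Arrival n₁ n₀ N) (t : ℕ) : ℕ :=
  ((Finset.Icc 1 M₀).filter
    fun k => ¬ References ω (t + k + ((ω (t + k)).exit : ℕ)) (t + n₁)).card

open Classical in
/-- `M₀⁻¹ (W(v₁) + ⋯ + W(vₙ)) / n`, where `v₁, v₂, …` are the transactions issued by the `k`-th
selfish node in the order of arrival. -/
noncomputable def averageCost (M₀ : ℕ) (k : Fin N) (ω : ℕ → Arrival n₁ n₀ N) (n : ℕ) : ℝ :=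
  (M₀ : ℝ)⁻¹ *
    ((∑ j ∈ Finset.range n,
      (unreferencedCount M₀ ω (Nat.nth (fun t => (ω t).issuer = some k) j) : ℝ)) / n)

end Trajectories

namespace TangleModel

variable {n₁ n₀ N : ℕ} (T : TangleModel n₁ n₀)

/-- The transition matrix of the window when all the nodes use the default strategy. -/
noncomputable def defaultMatrix : Matrix (Window n₁ n₀) (Window n₁ n₀) ℝ :=
  open Classical in
  fun x y => ∑ p with x.push p = y, (T.dflt : Window n₁ n₀ → SeenPair n₁ n₀ → ℝ) x p

/-- The law of the issuer of a transaction: nodes issue transactions independently with equal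
rates, hence it is a default node with probability `κ / (κ + 1)` and each of the `N` selfish ones
with probability `1 / ((κ + 1) N)`. -/
noncomputable def issuerWeight (N : ℕ) : Option (Fin N) → ℝ
  | none => T.κ / (T.κ + 1)
  | some _ => 1 / ((T.κ + 1) * N)

theorem issuerWeight_mem [NeZero N] : T.issuerWeight N ∈ stdSimplex ℝ (Option (Fin N)) := by
  have hκ := T.κ_pos
  have hN : (N : ℝ) ≠ 0 := Nat.cast_ne_zero.mpr (NeZero.ne N)
  refine ⟨fun i => ?_, ?_⟩
  · cases i <;> simp only [issuerWeight] <;> positivity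
  · rw [Fintype.sum_option]
    simp only [issuerWeight, Finset.sum_const, Finset.card_univ, Fintype.card_fin, nsmul_eq_mul]
    field_simp

/-- The strategy used by an issuer when the selfish nodes use `s`. -/
def strategyOf (s : Fin N → Strategy n₁ n₀) : Option (Fin N) → Strategy n₁ n₀
  | none => T.dflt
  | some k => s k

/-- The law of an arrival, given that the window is `x`: the issuer, then the pair chosen by
its strategy, and a walk independent of both. -/
noncomputable def arrivalLaw [NeZero N] (s : Fin N → Strategy n₁ n₀) (x : Window n₁ n₀) :
    PMF (Arrival n₁ n₀ N) :=
  (pmfOfSimplex (T.issuerWeight N) T.issuerWeight_mem).bind fun i =>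
    (pmfOfSimplex ((T.strategyOf s i).1 x) ((T.strategyOf s i).2.1 x)).bind fun p =>
      (pmfOfSimplex (T.walk x).1 (T.walk x).2).map fun y => ⟨x, i, p, y⟩

/-- The Markov kernel of the arrivals: the next window is obtained by attaching the
transaction. -/
noncomputable def arrivalKernel [NeZero N] (s : Fin N → Strategy n₁ n₀) :
    Kernel (Arrival n₁ n₀ N) (Arrival n₁ n₀ N) :=
  Kernel.ofFunOfCountable fun a => (T.arrivalLaw s (a.window.push a.pair)).toMeasure

instance [NeZero N] (s : Fin N → Strategy n₁ n₀) : IsMarkovKernel (T.arrivalKernel s) :=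
  ⟨fun a => by
    change IsProbabilityMeasure (T.arrivalLaw s (a.window.push a.pair)).toMeasure
    infer_instance⟩

/-- The law of the Markov chain of arrivals that starts from the window `x₀`, when the selfish
nodes use the strategies `s`. -/
noncomputable def tangleLaw [NeZero N] (s : Fin N → Strategy n₁ n₀) (x₀ : Window n₁ n₀) :
    Measure (ℕ → Arrival n₁ n₀ N) :=
  Kernel.trajMeasure (X := fun _ => Arrival n₁ n₀ N) (T.arrivalLaw s x₀).toMeasure
    fun n => (T.arrivalKernel s).comap
      (fun h : (Π _ : Finset.Iic n, Arrival n₁ n₀ N) => h ⟨n, Finset.mem_Iic.mpr le_rfl⟩)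
      (measurable_pi_apply _)

/-- `c` is the mean cost of the `k`-th selfish node: whatever the initial window, the limit that
defines the cost almost surely exists and is equal to `c`. -/
def HasMeanCost [NeZero N] (s : Fin N → Strategy n₁ n₀) (k : Fin N) (c : ℝ) : Prop :=
  ∀ x₀ : Window n₁ n₀, ∀ᵐ ω ∂(T.tangleLaw s x₀),
    Tendsto (averageCost T.M₀ k ω) atTop (𝓝 c)

open Classical in
/-- The mean cost of the `k`-th selfish node. -/
noncomputable def meanCost [NeZero N] (s : Fin N → Strategy n₁ n₀) (k : Fin N) : ℝ :=
  if h : ∃ c, T.HasMeanCost s k c then h.choose else 0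

/-- An `ε`-equilibrium for the strategy space `Q`: no node can decrease its cost by more than `ε`
by switching alone to another strategy of `Q`. -/
def IsApproxEquilibrium [NeZero N] (Q : Set (Window n₁ n₀ → SeenPair n₁ n₀ → ℝ)) (ε : ℝ)
    (s : Fin N → Strategy n₁ n₀) : Prop :=
  (∀ k, (s k : Window n₁ n₀ → SeenPair n₁ n₀ → ℝ) ∈ Q) ∧
    ∀ (k : Fin N) (S' : Strategy n₁ n₀), (S' : Window n₁ n₀ → SeenPair n₁ n₀ → ℝ) ∈ Q →
      T.meanCost s k ≤ T.meanCost (Function.update s k S') k + ε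

/-- A Nash equilibrium for the strategy space `Q`. -/
def IsNashEquilibrium [NeZero N] (Q : Set (Window n₁ n₀ → SeenPair n₁ n₀ → ℝ))
    (s : Fin N → Strategy n₁ n₀) : Prop :=
  (∀ k, (s k : Window n₁ n₀ → SeenPair n₁ n₀ → ℝ) ∈ Q) ∧
    ∀ (k : Fin N) (S' : Strategy n₁ n₀), (S' : Window n₁ n₀ → SeenPair n₁ n₀ → ℝ) ∈ Q →
      T.meanCost s k ≤ T.meanCost (Function.update s k S') k

end TangleModel

/-! Summing out the issuer of a transaction leaves an attachment law that involves the strategies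
only through `T.mix σ`, the κ-weighted mixture of the default strategy and the average σ of the
selfish ones (`sum_issuerWeight_mul`). A node's own strategy enters its cost in one further place,
the attachment of the transaction whose cost is counted. So the mean cost of node `k` is a
deterministic value `T.cost b σ S` with `S = s k` (`meanCost_eq_cost`), linear in `S` and jointly
continuous on a compact set (`continuousOn_cost`).

Replacing every strategy by the average does not change σ, so linearity in `S` gives the equality of
costs. A deviation to `S'` by node `k` in the original vector and one by node `j` in the symmetric
vector give averages at distance at most 1/N. By uniform continuity the two deviators' costs differ
by less than ε for large N, and averaging the Nash inequalities over `k` gives the ε-equilibrium.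

For the existence of the limits, irreducibility passes from the default chain to every mixture, so
the maximum principle makes the Poisson equation f = c + g - Pg solvable, with c continuous in the
data. Correcting by g gives a function of finitely many arrivals that is centered from every window.
Its shifts are uncorrelated beyond a finite range, and a second-moment law of large numbers applies.
Dividing by the frequency of a node's transactions gives its average cost per transaction. -/

/-! ### Strong law for bounded variables with finite-range correlations -/

section LawOfLargeNumbers

variable {Ω : Type*} [MeasurableSpace Ω] {P : Measure Ω} [IsProbabilityMeasure P]
  {Z : ℕ → Ω → ℝ} {C : ℝ} {m : ℕ}

theorem integrable_mul_of_bounded (hm : ∀ t, Measurable (Z t)) (hC : ∀ t ω, |Z t ω| ≤ C)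
    (s t : ℕ) : Integrable (fun ω => Z s ω * Z t ω) P := by
  refine Integrable.of_bound ((hm s).mul (hm t)).aestronglyMeasurable (C * C) (ae_of_all _ ?_)
  intro ω
  rw [Real.norm_eq_abs, abs_mul]
  exact mul_le_mul (hC s ω) (hC t ω) (abs_nonneg _) ((abs_nonneg _).trans (hC s ω))

theorem integral_mul_le_of_bounded (hC : ∀ t ω, |Z t ω| ≤ C) (s t : ℕ) :
    ∫ ω, Z s ω * Z t ω ∂P ≤ C ^ 2 := by
  have h := norm_integral_le_of_norm_le_const (μ := P) (f := fun ω => Z s ω * Z t ω) (C := C * C)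
    (ae_of_all _ fun ω => by
      rw [Real.norm_eq_abs, abs_mul]
      exact mul_le_mul (hC s ω) (hC t ω) (abs_nonneg _) ((abs_nonneg _).trans (hC s ω)))
  simp only [probReal_univ, mul_one] at h
  exact (le_abs_self _).trans (h.trans_eq (sq C).symm)

/-- The second moment of a sum of bounded variables with finite-range correlations grows at most
linearly. -/
theorem integral_sum_sq_le (hm : ∀ t, Measurable (Z t)) (hC : ∀ t ω, |Z t ω| ≤ C)
    (horth : ∀ s t, s + m < t → ∫ ω, Z s ω * Z t ω ∂P = 0) (n : ℕ) :
    ∫ ω, (∑ t ∈ Finset.range n, Z t ω) ^ 2 ∂P ≤ n * ((2 * m + 1) * C ^ 2) := by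
  have hexp : ∀ ω, (∑ t ∈ Finset.range n, Z t ω) ^ 2 =
      ∑ s ∈ Finset.range n, ∑ t ∈ Finset.range n, Z s ω * Z t ω := fun ω => by
    rw [sq, Finset.sum_mul_sum]
  simp only [hexp]
  rw [integral_finsetSum _ fun s _ => integrable_finsetSum _ fun t _ =>
    integrable_mul_of_bounded hm hC s t]
  have hrow : ∀ s ∈ Finset.range n,
      ∫ ω, ∑ t ∈ Finset.range n, Z s ω * Z t ω ∂P ≤ (2 * m + 1) * C ^ 2 := by
    intro s _
    rw [integral_finsetSum _ fun t _ => integrable_mul_of_bounded hm hC s t]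
    have hle : ∀ t ∈ Finset.range n, ∫ ω, Z s ω * Z t ω ∂P ≤
        if t ∈ Finset.Icc (s - m) (s + m) then C ^ 2 else 0 := by
      intro t _
      split_ifs with h
      · exact integral_mul_le_of_bounded hC s t
      · rw [Finset.mem_Icc] at h
        rcases lt_or_ge (s + m) t with h1 | h1
        · exact (horth s t h1).le
        · have h2 : t + m < s := by omega
          simp only [mul_comm (Z s _)]
          exact (horth t s h2).le
    refine (Finset.sum_le_sum hle).trans ?_
    rw [← Finset.sum_filter, Finset.sum_const, nsmul_eq_mul]
    refine mul_le_mul_of_nonneg_right ?_ (sq_nonneg C)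
    -- Only the indices within distance `m` of `s` contribute, at most `2 * m + 1` of them;
    -- truncated subtraction only shortens the interval.
    have h1 : ((Finset.range n).filter (· ∈ Finset.Icc (s - m) (s + m))).card ≤ 2 * m + 1 := by
      refine (Finset.card_le_card (t := Finset.Icc (s - m) (s + m)) ?_).trans ?_
      · intro t ht
        exact (Finset.mem_filter.mp ht).2
      · rw [Nat.card_Icc]
        omega
    exact_mod_cast h1
  refine (Finset.sum_le_sum hrow).trans ?_
  simp

/-- Bounded real sequences of increments whose averages vanish along the squares have vanishing
averages. -/
theorem tendsto_average_of_tendsto_average_sq {z : ℕ → ℝ} {C : ℝ} (hC : ∀ t, |z t| ≤ C)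
    (h : Tendsto (fun j : ℕ => (∑ t ∈ Finset.range (j ^ 2), z t) / (j : ℝ) ^ 2) atTop (𝓝 0)) :
    Tendsto (fun n : ℕ => (∑ t ∈ Finset.range n, z t) / n) atTop (𝓝 0) := by
  have hC0 : 0 ≤ C := (abs_nonneg _).trans (hC 0)
  have hsqrt : Tendsto Nat.sqrt atTop atTop := by
    refine tendsto_atTop_atTop.2 fun b => ⟨b ^ 2, fun a ha => ?_⟩
    rw [Nat.le_sqrt']
    exact ha
  have h1 := (tendsto_zero_iff_abs_tendsto_zero _).1 (h.comp hsqrt)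
  have h2 : Tendsto (fun n : ℕ => 2 * C / (Nat.sqrt n : ℝ)) atTop (𝓝 0) :=
    (tendsto_const_div_atTop_nhds_zero_nat (2 * C)).comp hsqrt
  refine squeeze_zero_norm' ?_ (by simpa using h1.add h2)
  filter_upwards [eventually_ge_atTop 1] with n hn
  -- Between consecutive squares there are at most `2 * j` further terms, which contribute at most
  -- `2 * j * C / j ^ 2 = 2 * C / j` to the average.
  set j := Nat.sqrt n with hj
  have hj1 : 1 ≤ j := by rw [hj, Nat.le_sqrt']; simpa using hn
  have hjn : j ^ 2 ≤ n := Nat.sqrt_le' n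
  have hnj : n < (j + 1) ^ 2 := Nat.lt_succ_sqrt' n
  have hsplit : ∑ t ∈ Finset.range n, z t =
      ∑ t ∈ Finset.range (j ^ 2), z t + ∑ t ∈ Finset.Ico (j ^ 2) n, z t :=
    (Finset.sum_range_add_sum_Ico _ hjn).symm
  have hrest : |∑ t ∈ Finset.Ico (j ^ 2) n, z t| ≤ 2 * j * C := by
    refine (Finset.abs_sum_le_sum_abs _ _).trans ((Finset.sum_le_sum fun t _ => hC t).trans ?_)
    rw [Finset.sum_const, Nat.card_Ico, nsmul_eq_mul]
    refine mul_le_mul_of_nonneg_right ?_ hC0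
    have : n - j ^ 2 ≤ 2 * j := by
      have : (j + 1) ^ 2 = j ^ 2 + 2 * j + 1 := by ring
      omega
    exact_mod_cast this
  have hjpos : (0 : ℝ) < j := by exact_mod_cast hj1
  have hjn' : (j : ℝ) ^ 2 ≤ n := by exact_mod_cast hjn
  rw [Real.norm_eq_abs, abs_div, Nat.abs_cast, hsplit]
  calc _ ≤ (|∑ t ∈ Finset.range (j ^ 2), z t| + |∑ t ∈ Finset.Ico (j ^ 2) n, z t|) / n := by
        gcongr
        exact abs_add_le _ _
    _ ≤ (|∑ t ∈ Finset.range (j ^ 2), z t| + 2 * j * C) / (j : ℝ) ^ 2 := by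
        gcongr
    _ = _ := by
        simp only [abs_div, abs_pow, Nat.abs_cast]
        field_simp

/-- A strong law of large numbers for bounded variables with finite-range correlations. -/
theorem ae_tendsto_average_zero (hm : ∀ t, Measurable (Z t)) (hC : ∀ t ω, |Z t ω| ≤ C)
    (horth : ∀ s t, s + m < t → ∫ ω, Z s ω * Z t ω ∂P = 0) :
    ∀ᵐ ω ∂P, Tendsto (fun n : ℕ => (∑ t ∈ Finset.range n, Z t ω) / n) atTop (𝓝 0) := by
  set D : ℝ := (2 * m + 1) * C ^ 2 with hD
  have hD0 : 0 ≤ D := by positivity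
  have hmeas : ∀ j : ℕ, Measurable fun ω =>
      ((∑ t ∈ Finset.range (j ^ 2), Z t ω) / (j : ℝ) ^ 2) ^ 2 := fun j =>
    ((Finset.measurable_sum _ fun t _ => hm t).div_const _).pow_const 2
  -- Along the squares the second moment of the average is at most `j ^ 2 * D / j ^ 4`, which is
  -- summable; hence almost surely the squared averages are summable and tend to zero.
  have hbound : ∀ j : ℕ, ∫⁻ ω, ENNReal.ofReal
      (((∑ t ∈ Finset.range (j ^ 2), Z t ω) / (j : ℝ) ^ 2) ^ 2) ∂P ≤
      ENNReal.ofReal (D / (j : ℝ) ^ 2) := by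
    intro j
    rw [← ofReal_integral_eq_lintegral_ofReal]
    · refine ENNReal.ofReal_le_ofReal ?_
      simp only [div_pow]
      rw [integral_div]
      have h := integral_sum_sq_le (P := P) hm hC horth (j ^ 2)
      rcases Nat.eq_zero_or_pos j with rfl | hj
      · simp
      · have hj' : (0 : ℝ) < j := by exact_mod_cast hj
        rw [div_le_div_iff₀ (by positivity) (by positivity)]
        push_cast at h
        calc _ ≤ ((j : ℝ) ^ 2 * D) * (j : ℝ) ^ 2 := by gcongr
          _ = _ := by ring
    · simp only [div_pow, sq (Finset.sum _ _), Finset.sum_mul_sum]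
      exact (integrable_finsetSum _ fun s _ => integrable_finsetSum _ fun t _ =>
        integrable_mul_of_bounded hm hC s t).div_const _
    · exact ae_of_all _ fun ω => sq_nonneg _
  have hsum : ∫⁻ ω, ∑' j : ℕ, ENNReal.ofReal
      (((∑ t ∈ Finset.range (j ^ 2), Z t ω) / (j : ℝ) ^ 2) ^ 2) ∂P ≠ ⊤ := by
    rw [lintegral_tsum fun j => (hmeas j).ennreal_ofReal.aemeasurable]
    refine ne_top_of_le_ne_top ?_ (ENNReal.tsum_le_tsum hbound)
    have hs : Summable fun j : ℕ => D / (j : ℝ) ^ 2 := by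
      simpa [div_eq_mul_inv] using (Real.summable_nat_pow_inv.2 one_lt_two).mul_left D
    exact hs.tsum_ofReal_ne_top
  filter_upwards [ae_lt_top (Measurable.tsum fun j => (hmeas j).ennreal_ofReal) hsum]
    with ω hω
  refine tendsto_average_of_tendsto_average_sq (C := C) (fun t => hC t ω) ?_
  have h1 := ENNReal.tendsto_atTop_zero_of_tsum_ne_top hω.ne
  have h2 := (ENNReal.tendsto_toReal ENNReal.zero_ne_top).comp h1
  rw [← Nat.cofinite_eq_atTop] at h2 ⊢
  have h3 : Tendsto (fun j : ℕ => ((∑ t ∈ Finset.range (j ^ 2), Z t ω) / (j : ℝ) ^ 2) ^ 2)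
      cofinite (𝓝 0) := by
    refine h2.congr fun j => ?_
    simp only [Function.comp]
    exact ENNReal.toReal_ofReal (sq_nonneg _)
  have h4 := (Real.continuous_sqrt.tendsto 0).comp h3
  simp only [Function.comp_def, Real.sqrt_sq_eq_abs, Real.sqrt_zero] at h4
  exact (tendsto_zero_iff_abs_tendsto_zero _).2 h4

end LawOfLargeNumbers

/-! ### Cylinders in path space -/

/-- The path that starts with `a` and continues with `ω`. -/
def consPath {α : Type*} (a : α) (ω : ℕ → α) : ℕ → α
  | 0 => a
  | n + 1 => ω n

theorem measurable_consPath {α : Type*} [MeasurableSpace α] (a : α) :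
    Measurable (consPath a) := by
  refine measurable_pi_iff.2 fun n => ?_
  cases n with
  | zero => exact measurable_const
  | succ n => exact measurable_pi_apply n

/-- The paths that agree with `a` up to time `n`. -/
def pathCylinder {α : Type*} (a : ℕ → α) (n : ℕ) : Set (ℕ → α) :=
  {ω | ∀ i ≤ n, ω i = a i}

theorem frestrictLe_preimage_singleton {α : Type*} (a : ℕ → α) (n : ℕ) :
    Preorder.frestrictLe (π := fun _ => α) n ⁻¹' {Preorder.frestrictLe (π := fun _ => α) n a} =
      pathCylinder a n := by
  ext ω
  simp only [Set.mem_preimage, Set.mem_singleton_iff, funext_iff, Subtype.forall, Finset.mem_Iic,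
    Preorder.frestrictLe_apply, pathCylinder, Set.mem_ofPred_eq]

theorem measurableSet_pathCylinder {α : Type*} [MeasurableSpace α] [MeasurableSingletonClass α]
    (a : ℕ → α) (n : ℕ) : MeasurableSet (pathCylinder a n) := by
  rw [← frestrictLe_preimage_singleton]
  exact Preorder.measurable_frestrictLe n (measurableSet_singleton _)

theorem consPath_preimage_pathCylinder_succ {α : Type*} (a : ℕ → α) (n : ℕ) :
    consPath (a 0) ⁻¹' pathCylinder a (n + 1) = pathCylinder (fun i => a (i + 1)) n := by
  ext ω
  constructor
  · intro h i hi
    exact h (i + 1) (by omega)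
  · intro h i hi
    cases i with
    | zero => rfl
    | succ i => exact h i (by omega)

theorem consPath_preimage_pathCylinder_of_ne {α : Type*} {a : ℕ → α} {b : α} (hb : b ≠ a 0)
    (n : ℕ) : consPath b ⁻¹' pathCylinder a n = ∅ := by
  ext ω
  simp only [Set.mem_preimage, Set.mem_empty_iff_false, iff_false]
  exact fun h => hb (h 0 (Nat.zero_le _))

/-- Finite measures on paths with finitely many states that agree on the cylinders are equal. -/
theorem ext_of_pathCylinder {α : Type*} [MeasurableSpace α] [MeasurableSingletonClass α]
    [Finite α] [Nonempty α] {μ ν : Measure (ℕ → α)} [IsFiniteMeasure μ]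
    (h : ∀ (a : ℕ → α) n, μ (pathCylinder a n) = ν (pathCylinder a n)) : μ = ν := by
  have hν : IsProjectiveLimit ν fun I : Finset ℕ => ν.map I.restrict := fun I => rfl
  have hμ : IsProjectiveLimit μ fun I : Finset ℕ => μ.map I.restrict := fun I => rfl
  have hfam : IsProjectiveMeasureFamily (α := fun _ : ℕ => α)
      fun I : Finset ℕ => μ.map I.restrict := by
    intro I J hJI
    rw [Measure.map_map (by fun_prop) (by fun_prop)]
    rfl
  -- Both measures are projective limits of the same family, and on a finite path space singletons,
  -- that is cylinders, determine each marginal.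
  refine hμ.unique ((isProjectiveLimit_nat_iff hfam ν).2 fun n => ?_)
  refine Measure.ext_of_singleton fun r => ?_
  obtain ⟨a, rfl⟩ : ∃ a : ℕ → α, Preorder.frestrictLe (π := fun _ => α) n a = r := by
    classical
    refine ⟨fun i => if hi : i ∈ Finset.Iic n then r ⟨i, hi⟩ else Classical.arbitrary α, ?_⟩
    ext ⟨i, hi⟩
    simp only [Preorder.frestrictLe_apply]
    rw [dif_pos hi]
  rw [Measure.map_apply (by fun_prop) (measurableSet_singleton _), frestrictLe_preimage_singleton,
    ← h]
  change _ = (μ.map (Preorder.frestrictLe n)) _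
  rw [Measure.map_apply (by fun_prop) (measurableSet_singleton _), frestrictLe_preimage_singleton]

/-! ### First-step decomposition of the law of the arrivals -/

noncomputable instance {n₁ n₀ N : ℕ} : Fintype (Arrival n₁ n₀ N) := Fintype.ofFinite _

namespace TangleModel

variable {n₁ n₀ N : ℕ} (T : TangleModel n₁ n₀) [NeZero N] (s : Fin N → Strategy n₁ n₀)

instance (x₀ : Window n₁ n₀) : IsProbabilityMeasure (T.tangleLaw s x₀) := by
  unfold tangleLaw
  infer_instance

theorem tangleLaw_pathCylinder_zero (x₀ : Window n₁ n₀) (a : ℕ → Arrival n₁ n₀ N) :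
    T.tangleLaw s x₀ (pathCylinder a 0) = T.arrivalLaw s x₀ (a 0) := by
  rw [← frestrictLe_preimage_singleton, ← Measure.map_apply (by fun_prop)
    (measurableSet_singleton _), tangleLaw, Kernel.trajMeasure, Measure.map_comp _ _ (by fun_prop),
    Kernel.traj_map_frestrictLe, Kernel.partialTraj_self, Measure.id_comp,
    Measure.map_apply (by fun_prop) (measurableSet_singleton _)]
  rw [show (MeasurableEquiv.piUnique fun _ : Finset.Iic 0 => Arrival n₁ n₀ N).symm ⁻¹'
    {Preorder.frestrictLe 0 a} = {a 0} from ?_]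
  · rw [PMF.toMeasure_apply_singleton _ _ (measurableSet_singleton _)]
  · ext b
    simp only [Set.mem_preimage, Set.mem_singleton_iff]
    constructor
    · intro h
      exact congrFun h ⟨0, by simp⟩
    · rintro rfl
      ext ⟨i, hi⟩
      obtain rfl : i = 0 := by simpa using hi
      rfl

/-- The Markov property: the path up to `n` together with the next arrival has a composition-product
law, evaluated here on a product of singletons. -/
theorem tangleLaw_pathCylinder_succ (x₀ : Window n₁ n₀) (a : ℕ → Arrival n₁ n₀ N) (n : ℕ) :
    T.tangleLaw s x₀ (pathCylinder a (n + 1)) = T.tangleLaw s x₀ (pathCylinder a n) *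
      T.arrivalLaw s ((a n).window.push (a n).pair) (a (n + 1)) := by
  have h := congrArg (fun μ => μ ({Preorder.frestrictLe n a} ×ˢ {a (n + 1)}))
    (Kernel.map_frestrictLe_trajMeasure_compProd_eq_map_trajMeasure
      (X := fun _ => Arrival n₁ n₀ N) (μ₀ := (T.arrivalLaw s x₀).toMeasure)
      (κ := fun n => (T.arrivalKernel s).comap
        (fun h : (Π _ : Finset.Iic n, Arrival n₁ n₀ N) => h ⟨n, Finset.mem_Iic.mpr le_rfl⟩)
        (measurable_pi_apply _)) (a := n))
  rw [Measure.compProd_apply_prod (measurableSet_singleton _) (measurableSet_singleton _),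
    Measure.restrict_singleton, lintegral_smul_measure, lintegral_dirac,
    Measure.map_apply (by fun_prop) (measurableSet_singleton _), frestrictLe_preimage_singleton,
    Measure.map_apply (by fun_prop)
      ((measurableSet_singleton _).prod (measurableSet_singleton _))] at h
  have hset : (fun x : ℕ → Arrival n₁ n₀ N => (Preorder.frestrictLe n x, x (n + 1))) ⁻¹'
      ({Preorder.frestrictLe n a} ×ˢ {a (n + 1)}) = pathCylinder a (n + 1) := by
    ext ω
    have h1 := congrArg (ω ∈ ·) (frestrictLe_preimage_singleton a n)
    simp only [Set.mem_preimage, eq_iff_iff] at h1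
    simp only [Set.mem_preimage, Set.mem_prod, h1, Set.mem_singleton_iff]
    constructor
    · rintro ⟨h1, h2⟩ i hi
      rcases Nat.lt_or_ge n i with h3 | h3
      · obtain rfl : i = n + 1 := by omega
        exact h2
      · exact h1 i h3
    · exact fun h => ⟨fun i hi => h i (by omega), h _ le_rfl⟩
  rw [hset] at h
  refine h.symm.trans ?_
  rw [smul_eq_mul]
  congr 1
  change (T.arrivalLaw s ((a n).window.push (a n).pair)).toMeasure {a (n + 1)} = _
  rw [PMF.toMeasure_apply_singleton _ _ (measurableSet_singleton _)]

/-- Splitting off the first arrival instead of the last identifies what follows as the law started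
from the pushed window. -/
theorem tangleLaw_pathCylinder_succ' (x₀ : Window n₁ n₀) (a : ℕ → Arrival n₁ n₀ N) (n : ℕ) :
    T.tangleLaw s x₀ (pathCylinder a (n + 1)) = T.arrivalLaw s x₀ (a 0) *
      T.tangleLaw s ((a 0).window.push (a 0).pair) (pathCylinder (fun i => a (i + 1)) n) := by
  induction n with
  | zero => rw [tangleLaw_pathCylinder_succ, tangleLaw_pathCylinder_zero,
      tangleLaw_pathCylinder_zero]
  | succ n ih =>
    rw [tangleLaw_pathCylinder_succ, ih, tangleLaw_pathCylinder_succ, mul_assoc]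

/-- The first-step decomposition of the law of the arrivals. -/
theorem tangleLaw_eq_sum (x₀ : Window n₁ n₀) :
    T.tangleLaw s x₀ = ∑ a, T.arrivalLaw s x₀ a •
      (T.tangleLaw s (a.window.push a.pair)).map (consPath a) := by
  obtain ⟨a₀, -⟩ := (T.arrivalLaw s x₀).support_nonempty
  have : Nonempty (Arrival n₁ n₀ N) := ⟨a₀⟩
  refine ext_of_pathCylinder fun a n => ?_
  have hcyl := measurableSet_pathCylinder a n
  simp only [Measure.coe_finsetSum, Finset.sum_apply, Measure.smul_apply, smul_eq_mul,
    Measure.map_apply (measurable_consPath _) hcyl]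
  rw [Finset.sum_eq_single (a 0)]
  · cases n with
    | zero =>
      rw [tangleLaw_pathCylinder_zero]
      have : consPath (a 0) ⁻¹' pathCylinder a 0 = Set.univ := by
        ext ω
        simp only [Set.mem_preimage, Set.mem_univ, iff_true]
        intro i hi
        obtain rfl : i = 0 := by omega
        rfl
      rw [this, measure_univ, mul_one]
    | succ n => rw [tangleLaw_pathCylinder_succ', consPath_preimage_pathCylinder_succ]
  · intro b _ hb
    rw [consPath_preimage_pathCylinder_of_ne hb, measure_empty, mul_zero]
  · simp

theorem sum_toReal_bind {α β : Type*} [Fintype α] [Fintype β] (p : PMF α) (f : α → PMF β)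
    (g : β → ℝ) : ∑ b, ((p.bind f) b).toReal * g b =
      ∑ a, (p a).toReal * ∑ b, (f a b).toReal * g b := by
  simp only [PMF.bind_apply, tsum_fintype]
  simp only [ENNReal.toReal_sum fun a _ =>
    ENNReal.mul_ne_top (PMF.apply_ne_top p a) (PMF.apply_ne_top (f a) _), ENNReal.toReal_mul,
    Finset.sum_mul, Finset.mul_sum]
  rw [Finset.sum_comm]
  simp only [mul_assoc]

theorem sum_toReal_map {α β : Type*} [Fintype α] [Fintype β] (p : PMF α) (f : α → β)
    (g : β → ℝ) : ∑ b, ((p.map f) b).toReal * g b = ∑ a, (p a).toReal * g (f a) := by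
  classical
  rw [← PMF.bind_pure_comp, sum_toReal_bind]
  refine Finset.sum_congr rfl fun a _ => ?_
  congr 1
  rw [Finset.sum_eq_single (f a)]
  · simp
  · intro b _ hb
    simp [hb]
  · simp

theorem toReal_pmfOfSimplex {α : Type} [Fintype α] (v : α → ℝ) (hv : v ∈ stdSimplex ℝ α) (a : α) :
    (pmfOfSimplex v hv a).toReal = v a := by
  rw [pmfOfSimplex, PMF.ofFintype_apply, ENNReal.toReal_ofReal (hv.1 a)]

theorem sum_toReal_arrivalLaw (x : Window n₁ n₀) (g : Arrival n₁ n₀ N → ℝ) :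
    ∑ a, (T.arrivalLaw s x a).toReal * g a = ∑ i, T.issuerWeight N i *
      ∑ p, (T.strategyOf s i).1 x p * ∑ e, (T.walk x).1 e * g ⟨x, i, p, e⟩ := by
  simp only [arrivalLaw, sum_toReal_bind, sum_toReal_map, toReal_pmfOfSimplex]

/-- The first-step decomposition of an expectation. -/
theorem integral_tangleLaw (x : Window n₁ n₀) {F : (ℕ → Arrival n₁ n₀ N) → ℝ}
    (hF : Measurable F) {C : ℝ} (hC : ∀ ω, |F ω| ≤ C) :
    ∫ ω, F ω ∂T.tangleLaw s x = ∑ i, T.issuerWeight N i *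
      ∑ p, (T.strategyOf s i).1 x p * ∑ e, (T.walk x).1 e *
        ∫ ω, F (consPath ⟨x, i, p, e⟩ ω) ∂T.tangleLaw s (x.push p) := by
  rw [← T.sum_toReal_arrivalLaw s x fun a =>
    ∫ ω, F (consPath a ω) ∂T.tangleLaw s (a.window.push a.pair)]
  have hint : ∀ a : Arrival n₁ n₀ N, Integrable F
      ((T.tangleLaw s (a.window.push a.pair)).map (consPath a)) := fun a => by
    have := Measure.isProbabilityMeasure_map (μ := T.tangleLaw s (a.window.push a.pair))
      (measurable_consPath a).aemeasurable
    exact Integrable.of_bound hF.aestronglyMeasurable C (ae_of_all _ hC)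
  conv_lhs => rw [tangleLaw_eq_sum]
  rw [integral_finsetSum_measure fun a _ => (hint a).smul_measure (PMF.apply_ne_top _ _)]
  refine Finset.sum_congr rfl fun a _ => ?_
  rw [integral_smul_measure, smul_eq_mul,
    integral_map (measurable_consPath a).aemeasurable hF.aestronglyMeasurable]

end TangleModel

/-! ### Functions of finitely many coordinates -/

section FinitePaths

variable {α : Type*} [Finite α] {F : (ℕ → α) → ℝ} {m : ℕ}

/-- Such a function factors through the finite set of restricted paths; this supplies all the
boundedness and integrability needed later. -/
theorem DependsOn.exists_abs_le [Nonempty α] (hF : DependsOn F (Set.Iic m)) :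
    ∃ C, ∀ ω, |F ω| ≤ C := by
  obtain ⟨g, rfl⟩ := dependsOn_iff_exists_comp.1 hF
  obtain ⟨C, hC⟩ := (Set.finite_range fun r => |g r|).bddAbove
  exact ⟨C, fun ω => hC ⟨_, rfl⟩⟩

theorem DependsOn.measurable_real [MeasurableSpace α] [MeasurableSingletonClass α]
    (hF : DependsOn F (Set.Iic m)) : Measurable F := by
  obtain ⟨g, rfl⟩ := dependsOn_iff_exists_comp.1 hF
  exact (measurable_of_finite g).comp (by fun_prop)

end FinitePaths

/-! ### Averaging over issuers, and the ergodic theorem from the Poisson equation -/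

namespace TangleModel

variable {n₁ n₀ N : ℕ} (T : TangleModel n₁ n₀)

/-- The overall attachment strategy when the selfish nodes use `σ`, or `σ` on average. -/
noncomputable def mix (σ : Window n₁ n₀ → SeenPair n₁ n₀ → ℝ) (x : Window n₁ n₀)
    (p : SeenPair n₁ n₀) : ℝ :=
  T.κ / (T.κ + 1) * T.dflt.1 x p + 1 / (T.κ + 1) * σ x p

variable [NeZero N] (s : Fin N → Strategy n₁ n₀)

theorem averageStrategy_apply (x : Window n₁ n₀) (p : SeenPair n₁ n₀) :
    (averageStrategy s).1 x p = (1 / (N : ℝ)) * ∑ k, (s k).1 x p := by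
  simp [averageStrategy, Finset.sum_apply]

/-- The selfish issuers have equal weights, so their strategies enter only through the average. This
is what makes the window chain of the original and of the symmetric vector the same. -/
theorem sum_issuerWeight_mul (x : Window n₁ n₀) (φ : SeenPair n₁ n₀ → ℝ) :
    ∑ i, T.issuerWeight N i * ∑ p, (T.strategyOf s i).1 x p * φ p =
      ∑ p, T.mix (averageStrategy s).1 x p * φ p := by
  have hκ := T.κ_pos
  have hN : (N : ℝ) ≠ 0 := Nat.cast_ne_zero.mpr (NeZero.ne N)
  simp only [Finset.mul_sum]
  rw [Finset.sum_comm]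
  refine Finset.sum_congr rfl fun p _ => ?_
  rw [Fintype.sum_option]
  simp only [issuerWeight, strategyOf, mix, averageStrategy_apply, ← Finset.mul_sum,
    ← Finset.sum_mul]
  field_simp

theorem sum_issuerWeight : ∑ i, T.issuerWeight N i = 1 := T.issuerWeight_mem.2

theorem sum_strategy (S : Strategy n₁ n₀) (x : Window n₁ n₀) : ∑ p, S.1 x p = 1 := (S.2.1 x).2

theorem sum_walk (x : Window n₁ n₀) : ∑ e, (T.walk x).1 e = 1 := (T.walk x).2.2

theorem nonempty_arrival (T : TangleModel n₁ n₀) (s : Fin N → Strategy n₁ n₀)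
    (x : Window n₁ n₀) : Nonempty (Arrival n₁ n₀ N) :=
  let ⟨a, _⟩ := (T.arrivalLaw s x).support_nonempty
  ⟨a⟩

variable {F H : (ℕ → Arrival n₁ n₀ N) → ℝ} {m : ℕ}

/-- The first-step decomposition for a function of finitely many arrivals. -/
theorem integral_of_dependsOn (x : Window n₁ n₀) (hF : DependsOn F (Set.Iic m)) :
    ∫ ω, F ω ∂T.tangleLaw s x = ∑ i, T.issuerWeight N i *
      ∑ p, (T.strategyOf s i).1 x p * ∑ e, (T.walk x).1 e *
        ∫ ω, F (consPath ⟨x, i, p, e⟩ ω) ∂T.tangleLaw s (x.push p) := by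
  have := T.nonempty_arrival s x
  obtain ⟨C, hC⟩ := hF.exists_abs_le
  exact T.integral_tangleLaw s x hF.measurable_real hC

theorem integral_window_zero (x : Window n₁ n₀) (g : Window n₁ n₀ → ℝ) :
    ∫ ω, g (ω 0).window ∂T.tangleLaw s x = g x := by
  rw [T.integral_of_dependsOn s x (m := 0) fun ω ω' h => by rw [h 0 (Set.mem_Iic.2 le_rfl)]]
  simp only [consPath, integral_const, probReal_univ, smul_eq_mul, one_mul, ← Finset.sum_mul,
    sum_issuerWeight, sum_strategy, sum_walk]

theorem integral_window_one (x : Window n₁ n₀) (g : Window n₁ n₀ → ℝ) :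
    ∫ ω, g (ω 1).window ∂T.tangleLaw s x =
      ∑ p, T.mix (averageStrategy s).1 x p * g (x.push p) := by
  rw [T.integral_of_dependsOn s x (m := 1) fun ω ω' h => by rw [h 1 (Set.mem_Iic.2 le_rfl)]]
  simp only [consPath, integral_window_zero, ← Finset.sum_mul, sum_walk, one_mul,
    sum_issuerWeight_mul]

/-- A function of the arrivals from time `t` on that is centered for every initial window is
orthogonal to the functions of the arrivals before `t`. -/
theorem integral_mul_shift_eq_zero (hF : DependsOn F (Set.Iic m))
    (h0 : ∀ x, ∫ ω, F ω ∂T.tangleLaw s x = 0) (t : ℕ) (hH : DependsOn H (Set.Iio t))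
    (x : Window n₁ n₀) :
    ∫ ω, H ω * F (fun i => ω (i + t)) ∂T.tangleLaw s x = 0 := by
  -- Conditioning on the first arrival gives the same claim for a smaller `t` from the pushed
  -- window, with that arrival frozen inside `H`. At `t = 0` the factor `H` is constant.
  induction t generalizing H x with
  | zero =>
    obtain ⟨a⟩ := T.nonempty_arrival s x
    have : ∀ ω, H ω = H fun _ => a := fun ω => hH fun i hi => absurd hi (by simp)
    simp only [this, add_zero, integral_const_mul, h0, mul_zero]
  | succ t ih =>
    rw [T.integral_of_dependsOn s x (m := m + (t + 1))]
    · refine Finset.sum_eq_zero fun i _ => ?_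
      rw [Finset.sum_eq_zero fun p _ => ?_, mul_zero]
      rw [Finset.sum_eq_zero fun e _ => ?_, mul_zero]
      refine mul_eq_zero_of_right _ (ih (H := fun ω => H (consPath ⟨x, i, p, e⟩ ω)) ?_ _)
      intro ω ω' h
      refine hH fun j hj => ?_
      cases j with
      | zero => rfl
      | succ j => exact h j (Set.mem_Iio.2 (Nat.lt_of_succ_lt_succ hj))
    · intro ω ω' h
      have h1 : H ω = H ω' := hH fun i hi => h i (by
        rw [Set.mem_Iio] at hi
        rw [Set.mem_Iic]
        omega)
      have h2 : F (fun i => ω (i + (t + 1))) = F (fun i => ω' (i + (t + 1))) :=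
        hF fun i hi => h _ (by
          rw [Set.mem_Iic] at hi ⊢
          omega)
      simp only [h1, h2]

theorem ae_tendsto_average_of_centered (hF : DependsOn F (Set.Iic m))
    (h0 : ∀ x, ∫ ω, F ω ∂T.tangleLaw s x = 0) (x : Window n₁ n₀) :
    ∀ᵐ ω ∂T.tangleLaw s x, Tendsto (fun n : ℕ =>
      (∑ t ∈ Finset.range n, F (fun i => ω (i + t))) / n) atTop (𝓝 0) := by
  have := T.nonempty_arrival s x
  obtain ⟨C, hC⟩ := hF.exists_abs_le
  have hmeas : ∀ t : ℕ, Measurable fun ω : ℕ → Arrival n₁ n₀ N => F fun i => ω (i + t) :=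
    fun t => hF.measurable_real.comp (measurable_pi_iff.2 fun i => measurable_pi_apply (i + t))
  have horth : ∀ r t : ℕ, r + m < t →
      ∫ ω, F (fun i => ω (i + r)) * F (fun i => ω (i + t)) ∂T.tangleLaw s x = 0 := by
    intro r t hrt
    have hH : DependsOn (fun ω : ℕ → Arrival n₁ n₀ N => F fun i => ω (i + r)) (Set.Iio t) := by
      intro ω ω' h
      refine hF fun i hi => h _ ?_
      rw [Set.mem_Iic] at hi
      rw [Set.mem_Iio]
      omega
    exact T.integral_mul_shift_eq_zero s hF h0 t hH x
  exact ae_tendsto_average_zero hmeas (fun t ω => hC _) horth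

/-- The ergodic theorem for a function of finitely many arrivals, given a solution of the Poisson
equation. -/
theorem ae_tendsto_average_of_poisson (hF : DependsOn F (Set.Iic m)) {g : Window n₁ n₀ → ℝ}
    {c : ℝ} (hg : ∀ x, ∫ ω, F ω ∂T.tangleLaw s x =
      c + g x - ∑ p, T.mix (averageStrategy s).1 x p * g (x.push p)) (x : Window n₁ n₀) :
    ∀ᵐ ω ∂T.tangleLaw s x, Tendsto (fun n : ℕ =>
      (∑ t ∈ Finset.range n, F (fun i => ω (i + t))) / n) atTop (𝓝 c) := by
  have hdep : ∀ j, DependsOn (fun ω : ℕ → Arrival n₁ n₀ N => g (ω j).window) (Set.Iic j) :=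
    fun j ω ω' h => by simp only [h j (Set.mem_Iic.2 le_rfl)]
  have hint : ∀ {G : (ℕ → Arrival n₁ n₀ N) → ℝ} {l : ℕ}, DependsOn G (Set.Iic l) → ∀ y,
      Integrable G (T.tangleLaw s y) := fun hG y => by
    have := T.nonempty_arrival s y
    obtain ⟨C, hC⟩ := hG.exists_abs_le
    exact Integrable.of_bound hG.measurable_real.aestronglyMeasurable C (ae_of_all _ hC)
  -- The Poisson equation says exactly that this corrected function has mean zero from every window;
  -- the correction telescopes along the path, so it does not affect the limit of averages.
  have hcent := T.ae_tendsto_average_of_centered s (m := m + 1)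
    (F := fun ω => F ω - c - g (ω 0).window + g (ω 1).window)
    (fun ω ω' h => by
      have h1 : F ω = F ω' := hF fun i hi => h i (Set.mem_Iic.2 ((Set.mem_Iic.1 hi).trans
        (Nat.le_succ m)))
      simp only [h1, h 0 (Set.mem_Iic.2 (Nat.zero_le _)),
        h 1 (Set.mem_Iic.2 (Nat.le_add_left 1 m))])
    (fun y => by
      have h1 : Integrable (fun ω => F ω - c) (T.tangleLaw s y) :=
        (hint hF y).sub (integrable_const c)
      have h2 : Integrable (fun ω => F ω - c - g (ω 0).window) (T.tangleLaw s y) :=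
        h1.sub (hint (hdep 0) y)
      rw [integral_add h2 (hint (hdep 1) y), integral_sub h1 (hint (hdep 0) y),
        integral_sub (hint hF y) (integrable_const c), integral_window_zero, integral_window_one,
        hg, integral_const, probReal_univ, one_smul]
      ring) x
  filter_upwards [hcent] with ω hω
  obtain ⟨C, hC⟩ := (Set.finite_range fun y => |g y|).bddAbove
  have hgC : ∀ y, |g y| ≤ C := fun y => hC ⟨y, rfl⟩
  have hbdd : Tendsto (fun n : ℕ => (g (ω 0).window - g (ω n).window) / n) atTop (𝓝 0) := by
    refine squeeze_zero_norm (fun n => ?_) (tendsto_const_div_atTop_nhds_zero_nat (C + C))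
    rw [Real.norm_eq_abs, abs_div, Nat.abs_cast]
    gcongr
    exact (abs_sub _ _).trans (add_le_add (hgC _) (hgC _))
  have hsum := (hω.add hbdd).add_const c
  rw [add_zero, zero_add] at hsum
  refine hsum.congr' ?_
  filter_upwards [eventually_gt_atTop 0] with n hn
  have hn' : (n : ℝ) ≠ 0 := by exact_mod_cast hn.ne'
  have htel : ∑ t ∈ Finset.range n, (F (fun i => ω (i + t)) - c - g (ω (0 + t)).window +
      g (ω (1 + t)).window) = ∑ t ∈ Finset.range n, F (fun i => ω (i + t)) - n * c +
        (g (ω n).window - g (ω 0).window) := by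
    rw [← Finset.sum_range_sub fun t => g (ω t).window]
    simp only [Finset.sum_add_distrib, Finset.sum_sub_distrib, zero_add, Finset.sum_const,
      Finset.card_range, nsmul_eq_mul, add_comm 1]
    ring
  rw [htel]
  field_simp
  ring

end TangleModel

instance {n₁ n₀ : ℕ} : Inhabited (Window n₁ n₀) :=
  ⟨⟨fun _ _ => 0, fun _ _ h => absurd rfl h, fun _ => by simp⟩⟩

/-! ### Poisson equation and continuity of the stationary mean -/

section Poisson

variable {n₁ n₀ : ℕ}

open Classical in
/-- The matrix of `h ↦ h - P h + h(x₀)`, where `P` is the transition matrix of the windows for the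
attachment strategy `q` and `x₀` is the default window. -/
noncomputable def poissonMatrix (q : Window n₁ n₀ → SeenPair n₁ n₀ → ℝ) :
    Matrix (Window n₁ n₀) (Window n₁ n₀) ℝ :=
  fun x y => (if x = y then 1 else 0) - (∑ p, if x.push p = y then q x p else 0) +
    if y = default then 1 else 0

open Classical in
/-- The stationary mean of `f` for the attachment strategy `q`, by way of the Poisson equation. -/
noncomputable def stationaryMean (q : Window n₁ n₀ → SeenPair n₁ n₀ → ℝ)
    (f : Window n₁ n₀ → ℝ) : ℝ :=
  ((poissonMatrix q)⁻¹.mulVec f) default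

theorem poissonMatrix_mulVec (q : Window n₁ n₀ → SeenPair n₁ n₀ → ℝ) (h : Window n₁ n₀ → ℝ)
    (x : Window n₁ n₀) : (poissonMatrix q).mulVec h x =
      h x - ∑ p, q x p * h (x.push p) + h default := by
  classical
  simp only [Matrix.mulVec, dotProduct, poissonMatrix, add_mul, sub_mul, Finset.sum_add_distrib,
    Finset.sum_sub_distrib, ite_mul, one_mul, zero_mul, Finset.sum_ite_eq, Finset.sum_ite_eq',
    Finset.mem_univ, if_true, Finset.sum_mul]
  rw [Finset.sum_comm]
  simp

end Poisson

namespace TangleModel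

variable {n₁ n₀ : ℕ} (T : TangleModel n₁ n₀)

/-- The window-wise probability measures on the pairs of seen vertices. -/
def simplexStrategies (n₁ n₀ : ℕ) : Set (Window n₁ n₀ → SeenPair n₁ n₀ → ℝ) :=
  Set.univ.pi fun _ => stdSimplex ℝ (SeenPair n₁ n₀)

theorem isCompact_simplexStrategies : IsCompact (simplexStrategies n₁ n₀) :=
  isCompact_univ_pi fun _ => isCompact_stdSimplex ℝ _

theorem mem_simplexStrategies (S : Strategy n₁ n₀) : S.1 ∈ simplexStrategies n₁ n₀ :=
  fun x _ => S.2.1 x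

variable {σ : Window n₁ n₀ → SeenPair n₁ n₀ → ℝ} (hσ : σ ∈ simplexStrategies n₁ n₀)

include hσ in
theorem mix_mem : T.mix σ ∈ simplexStrategies n₁ n₀ := by
  intro x _
  have hκ := T.κ_pos
  refine convex_stdSimplex ℝ (SeenPair n₁ n₀) (T.dflt.2.1 x) (hσ x trivial)
    (a := T.κ / (T.κ + 1)) (b := 1 / (T.κ + 1)) (by positivity) (by positivity) ?_
  field_simp

include hσ in
-- Since κ > 0, default nodes keep a positive share, so every transition of the default chain stays
-- possible whatever the selfish nodes do.
theorem mix_pos {x : Window n₁ n₀} {p : SeenPair n₁ n₀} (h : 0 < T.dflt.1 x p) :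
    0 < T.mix σ x p := by
  have hκ := T.κ_pos
  have := (hσ x trivial).1 p
  unfold mix
  positivity

include hσ in
/-- The maximum principle: only constant functions are harmonic. -/
theorem eq_of_harmonic (hirr : T.defaultMatrix.IsIrreducible) {h : Window n₁ n₀ → ℝ}
    (hh : ∀ x, h x = ∑ p, T.mix σ x p * h (x.push p)) (x y : Window n₁ n₀) : h x = h y := by
  obtain ⟨z, hz⟩ := Finite.exists_max h
  have hstep : ∀ a b, h a = h z → 0 < T.defaultMatrix a b → h b = h z := by
    intro a b ha hab
    classical
    obtain ⟨p, hp, hp0⟩ := Finset.exists_lt_of_sum_lt (f := fun _ => (0 : ℝ)) (by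
      simpa [defaultMatrix] using hab)
    obtain rfl := (Finset.mem_filter.1 hp).2
    have hq := (T.mix_mem hσ) a trivial
    -- At a maximum the average of the nonnegative gaps vanishes, so each gap with positive weight
    -- vanishes; irreducibility then carries the maximal value to every window.
    have hsum : ∑ r, T.mix σ a r * (h z - h (a.push r)) = 0 := by
      simp only [mul_sub, Finset.sum_sub_distrib, ← Finset.sum_mul, hq.2, ← hh a, ha, one_mul,
        sub_self]
    have h0 := (Finset.sum_eq_zero_iff_of_nonneg fun r _ =>
      mul_nonneg (hq.1 r) (sub_nonneg.2 (hz _))).1 hsum p (Finset.mem_univ p)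
    have := (mul_eq_zero.1 h0).resolve_left (T.mix_pos hσ hp0).ne'
    linarith
  have hall : ∀ w, h w = h z := by
    intro w
    let := T.defaultMatrix.toQuiver
    obtain ⟨p, -⟩ := hirr.connected z w
    induction p with
    | nil => rfl
    | cons _ e ih => exact hstep _ _ ih e.down
  rw [hall x, hall y]

include hσ in
-- A kernel vector satisfies h - Ph = -h(x₀). At a maximum of h the left side is nonnegative and at
-- a minimum nonpositive, so h(x₀) = 0; then h is harmonic, hence constant, hence zero.
theorem isUnit_det_poissonMatrix (hirr : T.defaultMatrix.IsIrreducible) :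
    letI := Classical.decEq (Window n₁ n₀)
    IsUnit (poissonMatrix (T.mix σ)).det := by
  let := Classical.decEq (Window n₁ n₀)
  rw [← Matrix.isUnit_iff_isUnit_det, ← Matrix.mulVec_injective_iff_isUnit]
  refine (injective_iff_map_eq_zero (poissonMatrix (T.mix σ)).mulVecLin).2 fun h hh => ?_
  have heq : ∀ x, h x - ∑ p, T.mix σ x p * h (x.push p) + h default = 0 := fun x => by
    rw [← poissonMatrix_mulVec]
    exact congrFun hh x
  have hq := T.mix_mem hσ
  have hle : h default ≤ 0 := by
    obtain ⟨z, hz⟩ := Finite.exists_max h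
    have : ∑ p, T.mix σ z p * h (z.push p) ≤ ∑ p, T.mix σ z p * h z :=
      Finset.sum_le_sum fun p _ => mul_le_mul_of_nonneg_left (hz _) ((hq z trivial).1 p)
    rw [← Finset.sum_mul, (hq z trivial).2] at this
    linarith [heq z]
  have hge : 0 ≤ h default := by
    obtain ⟨z, hz⟩ := Finite.exists_min h
    have : ∑ p, T.mix σ z p * h z ≤ ∑ p, T.mix σ z p * h (z.push p) :=
      Finset.sum_le_sum fun p _ => mul_le_mul_of_nonneg_left (hz _) ((hq z trivial).1 p)
    rw [← Finset.sum_mul, (hq z trivial).2] at this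
    linarith [heq z]
  funext x
  rw [T.eq_of_harmonic hσ hirr (h := h) (fun y => by linarith [heq y]) x default]
  exact le_antisymm hle hge

include hσ in
-- With g the preimage of f under the Poisson matrix, the constant is g(x₀), which is how
-- `stationaryMean` is defined.
theorem exists_poisson_solution (hirr : T.defaultMatrix.IsIrreducible) (f : Window n₁ n₀ → ℝ) :
    ∃ g : Window n₁ n₀ → ℝ, ∀ x, f x =
      stationaryMean (T.mix σ) f + g x - ∑ p, T.mix σ x p * g (x.push p) := by
  let := Classical.decEq (Window n₁ n₀)
  refine ⟨(poissonMatrix (T.mix σ))⁻¹.mulVec f, fun x => ?_⟩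
  have h := poissonMatrix_mulVec (T.mix σ) ((poissonMatrix (T.mix σ))⁻¹.mulVec f) x
  rw [Matrix.mulVec_mulVec, Matrix.mul_nonsing_inv _ (T.isUnit_det_poissonMatrix hσ hirr),
    Matrix.one_mulVec] at h
  rw [stationaryMean, h]
  ring

include hσ in
theorem stationaryMean_const (hirr : T.defaultMatrix.IsIrreducible) (c : ℝ) :
    stationaryMean (T.mix σ) (fun _ => c) = c := by
  let := Classical.decEq (Window n₁ n₀)
  have h : (poissonMatrix (T.mix σ)).mulVec (fun _ => c) = fun _ => c := by
    funext x
    rw [poissonMatrix_mulVec, ← Finset.sum_mul, (T.mix_mem hσ x trivial).2]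
    ring
  rw [stationaryMean]
  conv_lhs => rw [← h]
  rw [Matrix.mulVec_mulVec, Matrix.nonsing_inv_mul _ (T.isUnit_det_poissonMatrix hσ hirr),
    Matrix.one_mulVec]

/-- By Cramer's rule the inverse matrix is the adjugate over a determinant that does not vanish on
the simplices. -/
theorem continuousOn_stationaryMean (hirr : T.defaultMatrix.IsIrreducible) {β : Type*}
    [TopologicalSpace β] {B : Set β} {τ : β → Window n₁ n₀ → SeenPair n₁ n₀ → ℝ}
    {f : β → Window n₁ n₀ → ℝ} (hτ : ContinuousOn τ B) (hτB : Set.MapsTo τ B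
      (simplexStrategies n₁ n₀)) (hf : ContinuousOn f B) :
    ContinuousOn (fun b => stationaryMean (T.mix (τ b)) (f b)) B := by
  let := Classical.decEq (Window n₁ n₀)
  have hmat : Continuous fun σ : Window n₁ n₀ → SeenPair n₁ n₀ → ℝ => poissonMatrix (T.mix σ) := by
    refine continuous_pi fun x => continuous_pi fun y => ?_
    unfold poissonMatrix mix
    refine (continuous_const.sub (continuous_finsetSum _ fun p _ => ?_)).add continuous_const
    split_ifs <;> fun_prop
  have hdet : ContinuousOn (fun b => ((poissonMatrix (T.mix (τ b))).det)⁻¹) B :=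
    (hmat.matrix_det.comp_continuousOn hτ).inv₀ fun b hb =>
      (T.isUnit_det_poissonMatrix (hτB hb) hirr).ne_zero
  have hadj : ContinuousOn (fun b => (poissonMatrix (T.mix (τ b))).adjugate) B :=
    hmat.matrix_adjugate.comp_continuousOn hτ
  have heq : ∀ b, stationaryMean (T.mix (τ b)) (f b) = ((poissonMatrix (T.mix (τ b))).det)⁻¹ *
      ∑ x, (poissonMatrix (T.mix (τ b))).adjugate default x * f b x := by
    intro b
    rw [stationaryMean, Matrix.inv_def, Ring.inverse_eq_inv', Matrix.smul_mulVec, Pi.smul_apply,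
      smul_eq_mul]
    rfl
  simp only [heq]
  refine hdet.mul (continuousOn_finsetSum _ fun x _ => ContinuousOn.mul ?_ ?_)
  · exact continuousOn_pi.1 (continuousOn_pi.1 hadj default) x
  · exact continuousOn_pi.1 hf x

end TangleModel

/-! ### The cost count as a function of attachments and exits -/

section References

variable {n₁ n₀ N N' : ℕ}

/-- The attachments and the exits of the tip-selecting walks along a path of arrivals. -/
def trace (ω : ℕ → Arrival n₁ n₀ N) (t : ℕ) : SeenPair n₁ n₀ × Fin n₁ :=
  ((ω t).pair, (ω t).exit)

theorem trace_consPath (a : Arrival n₁ n₀ N) (ω : ℕ → Arrival n₁ n₀ N) :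
    trace (consPath a ω) = consPath (a.pair, a.exit) (trace ω) := by
  funext t
  cases t <;> rfl

theorem Approves.lt {ω : ℕ → Arrival n₁ n₀ N} {u w : ℕ} (h : Approves ω u w) : w < u := by
  obtain ⟨t, rfl, h⟩ := h
  have h1 := (ω t).pair.1.isLt
  have h2 := (ω t).pair.2.isLt
  omega

theorem References.lt {ω : ℕ → Arrival n₁ n₀ N} {u w : ℕ} (h : References ω u w) : w < u := by
  induction h with
  | single h => exact h.lt
  | tail _ h ih => exact h.lt.trans ih

theorem Approves.of_trace_eq {ω : ℕ → Arrival n₁ n₀ N} {ω' : ℕ → Arrival n₁ n₀ N'} {t t' m : ℕ}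
    (h : ∀ i ≤ m, trace ω (t + i) = trace ω' (t' + i)) {u w : ℕ} (hu : u ≤ t + m + n₁)
    (hw : t + n₁ ≤ w) (huw : Approves ω u w) : Approves ω' (t' + (u - t)) (t' + (w - t)) := by
  have hlt := huw.lt
  obtain ⟨r, rfl, h'⟩ := huw
  obtain ⟨i, rfl⟩ : ∃ i, r = t + i := ⟨r - t, by omega⟩
  have hp : (ω (t + i)).pair = (ω' (t' + i)).pair := congrArg Prod.fst (h i (by omega))
  refine ⟨t' + i, by omega, ?_⟩
  rw [← hp]
  omega

/-- Labels decrease along edges, so a path down to the vertex `t + n₁` uses only vertices at least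
that new; their edges are recorded in the trace, which may then be shifted in time. -/
theorem References.of_trace_eq {ω : ℕ → Arrival n₁ n₀ N} {ω' : ℕ → Arrival n₁ n₀ N'}
    {t t' m : ℕ} (h : ∀ i ≤ m, trace ω (t + i) = trace ω' (t' + i)) {u : ℕ}
    (hu : u ≤ t + m + n₁) (huv : References ω u (t + n₁)) :
    References ω' (t' + (u - t)) (t' + n₁) := by
  have hv : t + n₁ - t = n₁ := by omega
  induction huv using Relation.TransGen.head_induction_on with
  | single h' =>
    have := h'.of_trace_eq h hu le_rfl
    rw [hv] at this
    exact .single this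
  | head h' h'' ih =>
    exact .head (h'.of_trace_eq h hu (References.lt h'').le) (ih (h'.lt.le.trans hu))

theorem unreferencedCount_le_of_trace_eq {ω : ℕ → Arrival n₁ n₀ N} {ω' : ℕ → Arrival n₁ n₀ N'}
    {t t' m : ℕ} (h : ∀ i ≤ m, trace ω (t + i) = trace ω' (t' + i)) :
    unreferencedCount m ω t ≤ unreferencedCount m ω' t' := by
  classical
  unfold unreferencedCount
  refine Finset.card_le_card fun k hk => ?_
  rw [Finset.mem_filter] at hk ⊢
  refine ⟨hk.1, fun hk' => hk.2 ?_⟩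
  have hkm := (Finset.mem_Icc.1 hk.1).2
  have hexit : (ω (t + k)).exit = (ω' (t' + k)).exit := congrArg Prod.snd (h k hkm)
  have hlt := (ω' (t' + k)).exit.isLt
  have := hk'.of_trace_eq (ω' := ω) (m := m) (t := t') (t' := t)
    (fun i hi => (h i hi).symm) (by omega)
  rwa [show t + (t' + k + ((ω' (t' + k)).exit : ℕ) - t') = t + k + ((ω (t + k)).exit : ℕ) by
    rw [hexit]
    omega] at this

theorem unreferencedCount_congr {ω : ℕ → Arrival n₁ n₀ N} {ω' : ℕ → Arrival n₁ n₀ N'}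
    {t t' m : ℕ} (h : ∀ i ≤ m, trace ω (t + i) = trace ω' (t' + i)) :
    unreferencedCount m ω t = unreferencedCount m ω' t' :=
  le_antisymm (unreferencedCount_le_of_trace_eq h)
    (unreferencedCount_le_of_trace_eq fun i hi => (h i hi).symm)

/-- The number of unreferencing walks for the first arrival, as a function of the attachments and
the exits. -/
noncomputable def traceCount (m : ℕ) (r : ℕ → SeenPair n₁ n₀ × Fin n₁) : ℝ :=
  -- The window and the issuer are dummies: the count reads neither.
  unreferencedCount m (fun t => (⟨default, none, (r t).1, (r t).2⟩ : Arrival n₁ n₀ 0)) 0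

theorem unreferencedCount_eq_traceCount (m : ℕ) (ω : ℕ → Arrival n₁ n₀ N) (t : ℕ) :
    (unreferencedCount m ω t : ℝ) = traceCount m (trace fun i => ω (i + t)) := by
  unfold traceCount
  rw [unreferencedCount_congr fun i _ => ?_]
  simp only [trace, zero_add, add_comm t i]

theorem dependsOn_traceCount (m : ℕ) :
    DependsOn (traceCount (n₁ := n₁) (n₀ := n₀) m) (Set.Iic m) := by
  intro r r' h
  unfold traceCount
  rw [unreferencedCount_congr fun i hi => ?_]
  have hi' := h (0 + i) (Set.mem_Iic.2 ((zero_add i).trans_le hi))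
  simp only [trace, hi']

end References

/-! ### Expected counts and the stationary cost -/

namespace TangleModel

variable {n₁ n₀ N : ℕ} (T : TangleModel n₁ n₀)

/-- The expectation of a function of the first `m` attachments and exits, from the window `x` on,
when `q` is the overall attachment strategy; later attachments and exits are replaced by `b`. -/
noncomputable def traceMean (q : Window n₁ n₀ → SeenPair n₁ n₀ → ℝ)
    (b : ℕ → SeenPair n₁ n₀ × Fin n₁) :
    ℕ → Window n₁ n₀ → ((ℕ → SeenPair n₁ n₀ × Fin n₁) → ℝ) → ℝ
  | 0, _, F => F b
  | m + 1, x, F => ∑ p, q x p * ∑ e, (T.walk x).1 e *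
      traceMean q b m (x.push p) fun r => F (consPath (p, e) r)

theorem continuous_traceMean (b : ℕ → SeenPair n₁ n₀ × Fin n₁) (m : ℕ) (x : Window n₁ n₀)
    (F : (ℕ → SeenPair n₁ n₀ × Fin n₁) → ℝ) :
    Continuous fun q => T.traceMean q b m x F := by
  induction m generalizing x F with
  | zero => exact continuous_const
  | succ m ih =>
    refine continuous_finsetSum _ fun p _ => Continuous.mul (by fun_prop) ?_
    exact continuous_finsetSum _ fun e _ => continuous_const.mul (ih _ _)

variable [NeZero N] (s : Fin N → Strategy n₁ n₀)

/-- The trace forgets the issuers, so its law depends on the strategies through the mixture alone.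
The filler `b` is never read by a function of the first `m` coordinates. -/
theorem integral_trace (b : ℕ → SeenPair n₁ n₀ × Fin n₁) (m : ℕ) (x : Window n₁ n₀)
    {F : (ℕ → SeenPair n₁ n₀ × Fin n₁) → ℝ} (hF : DependsOn F (Set.Iio m)) :
    ∫ ω, F (trace ω) ∂T.tangleLaw s x = T.traceMean (T.mix (averageStrategy s).1) b m x F := by
  induction m generalizing x F with
  | zero =>
    have : ∀ r, F r = F b := fun r => hF fun i hi => absurd hi (by simp)
    simp [this, traceMean]
  | succ m ih =>
    rw [T.integral_of_dependsOn s x (m := m)]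
    · rw [traceMean, ← T.sum_issuerWeight_mul s x]
      refine Finset.sum_congr rfl fun i _ => ?_
      congr 1
      refine Finset.sum_congr rfl fun p _ => ?_
      congr 1
      refine Finset.sum_congr rfl fun e _ => ?_
      congr 1
      simp only [trace_consPath]
      refine ih (x.push p) (F := fun r => F (consPath (p, e) r)) fun r r' h => hF fun i hi => ?_
      cases i with
      | zero => rfl
      | succ i => exact h i (Set.mem_Iio.2 (Nat.lt_of_succ_lt_succ hi))
    · intro ω ω' h
      refine hF fun i hi => ?_
      simp only [trace, h i (Set.mem_Iic.2 (Nat.lt_succ_iff.1 hi))]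

/-- The expected number of walks that do not reference a transaction attached to `p` in the
window `x`. -/
noncomputable def expectedCount (q : Window n₁ n₀ → SeenPair n₁ n₀ → ℝ)
    (b : ℕ → SeenPair n₁ n₀ × Fin n₁) (x : Window n₁ n₀) (p : SeenPair n₁ n₀) : ℝ :=
  ∑ e, (T.walk x).1 e * T.traceMean q b T.M₀ (x.push p) fun r => traceCount T.M₀ (consPath (p, e) r)

/-- The stationary cost of a node that uses `S` when `σ` is the average strategy of the selfish
nodes. -/
noncomputable def cost (b : ℕ → SeenPair n₁ n₀ × Fin n₁)
    (σ S : Window n₁ n₀ → SeenPair n₁ n₀ → ℝ) : ℝ :=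
  (T.M₀ : ℝ)⁻¹ * stationaryMean (T.mix σ) fun x => ∑ p, S x p * T.expectedCount (T.mix σ) b x p

open Classical in
-- The indicator selects the strategy of node `k` for the first attachment only; all later arrivals
-- are averaged over issuers. Hence the linearity in the node's own strategy.
theorem integral_issuer_mul_traceCount (b : ℕ → SeenPair n₁ n₀ × Fin n₁) (k : Fin N)
    (x : Window n₁ n₀) :
    ∫ ω, (if (ω 0).issuer = some k then 1 else 0) * traceCount T.M₀ (trace ω) ∂T.tangleLaw s x =
      1 / ((T.κ + 1) * N) *
        ∑ p, (s k).1 x p * T.expectedCount (T.mix (averageStrategy s).1) b x p := by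
  rw [T.integral_of_dependsOn s x (m := T.M₀)]
  · rw [Finset.sum_eq_single (some k)]
    · simp only [issuerWeight, strategyOf, expectedCount, consPath, if_true, one_mul,
        trace_consPath]
      congr 1
      refine Finset.sum_congr rfl fun p _ => ?_
      congr 1
      refine Finset.sum_congr rfl fun e _ => ?_
      congr 1
      -- The count reads the coordinates `0, …, M₀`; once the first arrival is split off, exactly
      -- `M₀` remain.
      refine T.integral_trace s b T.M₀ (x.push p) fun r r' h => dependsOn_traceCount _ fun i hi => ?_
      cases i with
      | zero => rfl
      | succ i => exact h i (Set.mem_Iio.2 (Nat.lt_of_succ_le hi))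
    · intro i _ hi
      simp [consPath, hi]
    · simp
  · intro ω ω' h
    have h1 : traceCount T.M₀ (trace ω) = traceCount T.M₀ (trace ω') :=
      dependsOn_traceCount _ fun i hi => by simp only [trace, h i hi]
    simp only [h1, h 0 (Set.mem_Iic.2 (Nat.zero_le _))]

open Classical in
theorem integral_issuer (k : Fin N) (x : Window n₁ n₀) :
    ∫ ω, (if (ω 0).issuer = some k then 1 else 0 : ℝ) ∂T.tangleLaw s x =
      1 / ((T.κ + 1) * N) := by
  rw [T.integral_of_dependsOn s x (m := 0) fun ω ω' h => by rw [h 0 (Set.mem_Iic.2 le_rfl)]]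
  rw [Finset.sum_eq_single (some k)]
  · simp only [consPath, if_true, integral_const, probReal_univ, one_smul, mul_one, sum_walk,
      sum_strategy, issuerWeight]
  · intro i _ hi
    simp [consPath, hi]
  · simp

end TangleModel

/-! ### From time averages to averages over selected times -/

theorem sum_indicator_eq_sum_nth (p : ℕ → Prop) [DecidablePred p] (w : ℕ → ℝ) (n : ℕ) :
    ∑ t ∈ Finset.range n, (if p t then 1 else 0) * w t =
      ∑ j ∈ Finset.range (Nat.count p n), w (Nat.nth p j) := by
  induction n with
  | zero => simp
  | succ n ih =>
    rw [Finset.sum_range_succ, ih, Nat.count_succ]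
    split_ifs with h
    · rw [Finset.sum_range_succ, Nat.nth_count h, one_mul]
    · simp

/-- Averages over the times at which `p` holds. -/
theorem tendsto_average_nth {p : ℕ → Prop} [DecidablePred p] {w : ℕ → ℝ} {a c : ℝ} (hc : 0 < c)
    (hp : Tendsto (fun n : ℕ => (∑ t ∈ Finset.range n, if p t then (1 : ℝ) else 0) / n) atTop (𝓝 c))
    (hw : Tendsto (fun n : ℕ => (∑ t ∈ Finset.range n, (if p t then 1 else 0) * w t) / n) atTop
      (𝓝 a)) :
    Tendsto (fun n : ℕ => (∑ j ∈ Finset.range n, w (Nat.nth p j)) / n) atTop (𝓝 (a / c)) := by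
  have hcount : ∀ n, (∑ t ∈ Finset.range n, if p t then (1 : ℝ) else 0) = Nat.count p n := by
    intro n
    have := sum_indicator_eq_sum_nth p (fun _ => 1) n
    simpa using this
  -- A positive limiting frequency forces infinitely many occurrences, so `Nat.nth p` takes no junk
  -- values.
  have hinf : (Set.ofPred p).Infinite := by
    intro hfin
    have h0 : Tendsto (fun n : ℕ => (∑ t ∈ Finset.range n, if p t then (1 : ℝ) else 0) / n) atTop
        (𝓝 0) := by
      refine squeeze_zero (fun n => by rw [hcount]; positivity) (fun n => ?_)
        (tendsto_const_div_atTop_nhds_zero_nat (hfin.toFinset.card : ℝ))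
      rw [hcount]
      gcongr
      rw [Nat.count_eq_card_filter_range]
      exact Finset.card_le_card fun t ht => by
        rw [Set.Finite.mem_toFinset]
        exact (Finset.mem_filter.1 ht).2
    exact hc.ne (tendsto_nhds_unique h0 hp)
  have hnth : Tendsto (Nat.nth p) atTop atTop := (Nat.nth_strictMono hinf).tendsto_atTop
  -- Just before the time `Nat.nth p n` exactly `n` occurrences have been counted, and the two
  -- divisions by elapsed time cancel.
  refine ((hw.div hp hc.ne').comp hnth).congr' ?_
  filter_upwards [eventually_gt_atTop 0] with n hn
  have hpos : (Nat.nth p n : ℝ) ≠ 0 := by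
    have : 0 < Nat.nth p n := (Nat.zero_le _).trans_lt (Nat.nth_strictMono hinf hn)
    exact_mod_cast this.ne'
  simp only [Function.comp, Pi.div_apply]
  rw [sum_indicator_eq_sum_nth, hcount, Nat.count_nth_of_infinite hinf]
  rw [div_div_div_cancel_right₀ hpos]

theorem stationaryMean_mul_sum {n₁ n₀ : ℕ} {ι : Type*} (t : Finset ι)
    (q : Window n₁ n₀ → SeenPair n₁ n₀ → ℝ) (c : ℝ) (f : ι → Window n₁ n₀ → ℝ) :
    stationaryMean q (fun x => c * ∑ i ∈ t, f i x) = c * ∑ i ∈ t, stationaryMean q (f i) := by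
  simp only [stationaryMean, Matrix.mulVec, dotProduct, Finset.mul_sum]
  rw [Finset.sum_comm]
  refine Finset.sum_congr rfl fun i _ => Finset.sum_congr rfl fun x _ => ?_
  ring

/-! ### The mean cost as a function of the average and the own strategy -/

namespace TangleModel

variable {n₁ n₀ N : ℕ} (T : TangleModel n₁ n₀)

theorem continuousOn_cost (hirr : T.defaultMatrix.IsIrreducible)
    (b : ℕ → SeenPair n₁ n₀ × Fin n₁) :
    ContinuousOn (fun z : (Window n₁ n₀ → SeenPair n₁ n₀ → ℝ) ×
      (Window n₁ n₀ → SeenPair n₁ n₀ → ℝ) => T.cost b z.1 z.2)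
      (simplexStrategies n₁ n₀ ×ˢ simplexStrategies n₁ n₀) := by
  refine continuousOn_const.mul (T.continuousOn_stationaryMean hirr continuous_fst.continuousOn
    (fun z hz => hz.1) (Continuous.continuousOn ?_))
  have hmix : Continuous (T.mix) := by
    refine continuous_pi fun x => continuous_pi fun p => ?_
    unfold mix
    fun_prop
  refine continuous_pi fun x => continuous_finsetSum _ fun p _ => Continuous.mul (by fun_prop) ?_
  exact continuous_finsetSum _ fun e _ => continuous_const.mul
    ((T.continuous_traceMean _ _ _ _).comp (hmix.comp continuous_fst))

variable [NeZero N] (s : Fin N → Strategy n₁ n₀)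

theorem cost_averageStrategy (b : ℕ → SeenPair n₁ n₀ × Fin n₁)
    (σ : Window n₁ n₀ → SeenPair n₁ n₀ → ℝ) :
    T.cost b σ (averageStrategy s).1 = (1 / (N : ℝ)) * ∑ k, T.cost b σ (s k).1 := by
  unfold cost
  rw [← Finset.mul_sum, mul_left_comm, ← stationaryMean_mul_sum]
  congr 2
  funext x
  simp only [averageStrategy_apply, Finset.mul_sum, Finset.sum_mul]
  rw [Finset.sum_comm]
  simp only [mul_assoc]

/-- The ergodic theorem applies both to the indicator of the issuer and to the count weighted by it;
the common factor `w`, the issuing probability, cancels in the ratio. -/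
theorem hasMeanCost_cost (hirr : T.defaultMatrix.IsIrreducible)
    (b : ℕ → SeenPair n₁ n₀ × Fin n₁) (k : Fin N) :
    T.HasMeanCost s k (T.cost b (averageStrategy s).1 (s k).1) := by
  classical
  intro x₀
  have hκ := T.κ_pos
  have hN : (0 : ℝ) < N := Nat.cast_pos.mpr (NeZero.pos N)
  set w : ℝ := 1 / ((T.κ + 1) * N) with hw
  have hwpos : 0 < w := by positivity
  have hσ := mem_simplexStrategies (averageStrategy s)
  obtain ⟨g, hg⟩ := T.exists_poisson_solution hσ hirr fun _ => w
  rw [T.stationaryMean_const hσ hirr] at hg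
  obtain ⟨g', hg'⟩ := T.exists_poisson_solution hσ hirr fun x =>
    w * ∑ p, (s k).1 x p * T.expectedCount (T.mix (averageStrategy s).1) b x p
  have hfreq := T.ae_tendsto_average_of_poisson s (m := 0)
    (F := fun ω => if (ω 0).issuer = some k then 1 else 0)
    (fun ω ω' h => by simp only [h 0 (Set.mem_Iic.2 le_rfl)])
    (fun x => (T.integral_issuer s k x).trans (hg x)) x₀
  have hcost := T.ae_tendsto_average_of_poisson s (m := T.M₀)
    (F := fun ω => (if (ω 0).issuer = some k then 1 else 0) * traceCount T.M₀ (trace ω))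
    (fun ω ω' h => by
      have h1 : traceCount T.M₀ (trace ω) = traceCount T.M₀ (trace ω') :=
        dependsOn_traceCount _ fun i hi => by simp only [trace, h i hi]
      simp only [h1, h 0 (Set.mem_Iic.2 (Nat.zero_le _))])
    (fun x => (T.integral_issuer_mul_traceCount s b k x).trans (hg' x)) x₀
  filter_upwards [hfreq, hcost] with ω h1 h2
  simp only [zero_add, ← unreferencedCount_eq_traceCount] at h1 h2
  have h3 := (tendsto_average_nth (p := fun t => (ω t).issuer = some k)
    (w := fun t => (unreferencedCount T.M₀ ω t : ℝ)) hwpos h1 h2).const_mul (T.M₀ : ℝ)⁻¹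
  -- A one-term sum, used only to take the scalar `w` out of the stationary mean.
  have hlin := stationaryMean_mul_sum (Finset.univ : Finset Unit) (T.mix (averageStrategy s).1) w
    fun _ x => ∑ p, (s k).1 x p * T.expectedCount (T.mix (averageStrategy s).1) b x p
  simp only [Finset.univ_unique, Finset.sum_singleton] at hlin
  rw [hlin, mul_div_cancel_left₀ _ hwpos.ne'] at h3
  exact h3

theorem HasMeanCost.unique {s : Fin N → Strategy n₁ n₀} {k : Fin N} {c c' : ℝ}
    (h : T.HasMeanCost s k c) (h' : T.HasMeanCost s k c') : c = c' := by
  obtain ⟨ω, h1, h2⟩ := ((h default).and (h' default)).exists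
  exact tendsto_nhds_unique h1 h2

theorem hasMeanCost_meanCost (hirr : T.defaultMatrix.IsIrreducible)
    (b : ℕ → SeenPair n₁ n₀ × Fin n₁) (k : Fin N) : T.HasMeanCost s k (T.meanCost s k) := by
  have h : ∃ c, T.HasMeanCost s k c := ⟨_, T.hasMeanCost_cost s hirr b k⟩
  rw [meanCost, dif_pos h]
  exact h.choose_spec

theorem meanCost_eq_cost (hirr : T.defaultMatrix.IsIrreducible)
    (b : ℕ → SeenPair n₁ n₀ × Fin n₁) (k : Fin N) :
    T.meanCost s k = T.cost b (averageStrategy s).1 (s k).1 :=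
  HasMeanCost.unique T (T.hasMeanCost_meanCost s hirr b k) (T.hasMeanCost_cost s hirr b k)

theorem averageStrategy_update_apply (k : Fin N) (S' : Strategy n₁ n₀) (x : Window n₁ n₀)
    (p : SeenPair n₁ n₀) : (averageStrategy (Function.update s k S')).1 x p =
      (averageStrategy s).1 x p + (1 / (N : ℝ)) * (S'.1 x p - (s k).1 x p) := by
  simp only [averageStrategy_apply, ← mul_add]
  congr 1
  rw [← Finset.add_sum_erase _ _ (Finset.mem_univ k), Function.update_self,
    ← Finset.add_sum_erase _ (fun j => (s j).1 x p) (Finset.mem_univ k)]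
  rw [Finset.sum_congr rfl fun j hj => by rw [Function.update_of_ne (Finset.ne_of_mem_erase hj)]]
  ring

theorem averageStrategy_const (S : Strategy n₁ n₀) : averageStrategy (fun _ : Fin N => S) = S := by
  have hN : (N : ℝ) ≠ 0 := Nat.cast_ne_zero.mpr (NeZero.ne N)
  refine Subtype.ext (funext fun x => funext fun p => ?_)
  rw [averageStrategy_apply]
  simp [hN]

/-- Replacing all the strategies by their average, while one node deviates, changes the average
strategy by at most `1 / N`. -/
theorem dist_averageStrategy_update_le (k j : Fin N) (S' : Strategy n₁ n₀) :
    dist (averageStrategy (Function.update s k S')).1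
      (averageStrategy (Function.update (fun _ => averageStrategy s) j S')).1 ≤ 1 / (N : ℝ) := by
  have h0 : (0 : ℝ) ≤ 1 / (N : ℝ) := by positivity
  refine (dist_pi_le_iff h0).2 fun x => (dist_pi_le_iff h0).2 fun p => ?_
  rw [Real.dist_eq, averageStrategy_update_apply, averageStrategy_update_apply,
    averageStrategy_const]
  have hmem : ∀ S : Strategy n₁ n₀, S.1 x p ∈ Set.Icc 0 1 := fun S =>
    mem_Icc_of_mem_stdSimplex (S.2.1 x) p
  have h1 := hmem (averageStrategy s)
  have h2 := hmem (s k)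
  -- The common deviation `S'` cancels, leaving `1 / N` times the difference of two numbers in `[0,
  -- 1]`.
  rw [add_sub_add_left_eq_sub, ← mul_sub, abs_mul, abs_of_nonneg h0]
  refine mul_le_of_le_one_right h0 (abs_le.2 ⟨?_, ?_⟩) <;> linarith [h1.1, h1.2, h2.1, h2.2]

end TangleModel

/-! ### The averaged vector is an ε-equilibrium -/

theorem theorem3 {n₁ n₀ : ℕ} (hn : n₀ < n₁) (T : TangleModel n₁ n₀)
    (hirr : T.defaultMatrix.IsIrreducible) (haper : IsAperiodicMatrix T.defaultMatrix) :
    (∀ (N : ℕ) [NeZero N] (s : Fin N → Strategy n₁ n₀) (k : Fin N),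
      T.HasMeanCost s k (T.meanCost s k)) ∧
    ∀ ε : ℝ, 0 < ε → ∃ N₀ : ℕ,
      ∀ A : Set (Window n₁ n₀ → SeenPair n₁ n₀ → ℝ), A ⊆ strategies n₁ n₀ → IsCompact A →
      ∀ (N : ℕ) [NeZero N], N₀ ≤ N → ∀ s : Fin N → Strategy n₁ n₀,
        T.IsNashEquilibrium (convexHull ℝ A) s →
          T.IsApproxEquilibrium (convexHull ℝ A) ε (fun _ : Fin N => averageStrategy s) ∧
          ∀ j : Fin N, T.meanCost (fun _ : Fin N => averageStrategy s) j =
            (1 / (N : ℝ)) * ∑ k, T.meanCost s k := by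
  obtain ⟨b⟩ : Nonempty (ℕ → SeenPair n₁ n₀ × Fin n₁) :=
    ⟨fun _ => ((⟨0, by omega⟩, ⟨0, by omega⟩), ⟨0, by omega⟩)⟩
  refine ⟨fun N _ s k => T.hasMeanCost_meanCost s hirr b k, fun ε hε => ?_⟩
  -- Uniform continuity is taken on the full product of simplices, not on the hull of `A`, so that δ
  -- and `N₀` do not depend on `A`.
  have hunif := (TangleModel.isCompact_simplexStrategies.prod
    TangleModel.isCompact_simplexStrategies).uniformContinuousOn_of_continuous
      (T.continuousOn_cost hirr b)
  obtain ⟨δ, hδ, hδε⟩ := Metric.uniformContinuousOn_iff.1 hunif ε hε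
  obtain ⟨N₀, hN₀⟩ := exists_nat_gt (1 / δ)
  refine ⟨N₀, fun A _ _ N _ hN s hs => ?_⟩
  have hNpos : (0 : ℝ) < N := Nat.cast_pos.mpr (NeZero.pos N)
  have hNδ : 1 / (N : ℝ) < δ := by
    rw [div_lt_comm₀ hNpos hδ]
    exact hN₀.trans_le (by exact_mod_cast hN)
  have havg : ∀ j : Fin N, T.meanCost (fun _ : Fin N => averageStrategy s) j =
      (1 / (N : ℝ)) * ∑ k, T.meanCost s k := fun j => by
    simp only [T.meanCost_eq_cost _ hirr b, TangleModel.averageStrategy_const]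
    exact T.cost_averageStrategy s b _
  refine ⟨⟨fun _ => ?_, fun j S' hS' => ?_⟩, havg⟩
  · change (1 / (N : ℝ)) • ∑ k, (s k).1 ∈ convexHull ℝ A
    rw [Finset.smul_sum]
    refine (convex_convexHull ℝ A).sum_mem (fun _ _ => by positivity) ?_ fun k _ => hs.1 k
    simp [hNpos.ne']
  -- Every node `k` of the original equilibrium is tested against the same deviation `S'`; the right
  -- side does not depend on `k`, so averaging over `k` bounds the common cost in the symmetric
  -- vector.
  · have hle : ∀ k : Fin N, T.meanCost s k ≤
        T.meanCost (Function.update (fun _ => averageStrategy s) j S') j + ε := by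
      intro k
      refine (hs.2 k S' hS').trans ?_
      simp only [T.meanCost_eq_cost _ hirr b, Function.update_self]
      have hd := hδε
        ((averageStrategy (Function.update s k S')).1, S'.1)
        ⟨TangleModel.mem_simplexStrategies _, TangleModel.mem_simplexStrategies _⟩
        ((averageStrategy (Function.update (fun _ => averageStrategy s) j S')).1, S'.1)
        ⟨TangleModel.mem_simplexStrategies _, TangleModel.mem_simplexStrategies _⟩ (by
          rw [Prod.dist_eq, dist_self, max_eq_left dist_nonneg]
          exact (TangleModel.dist_averageStrategy_update_le s k j S').trans_lt hNδ)
      rw [Real.dist_eq] at hd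
      linarith [(abs_lt.1 hd).2]
    rw [havg j, one_div, inv_mul_le_iff₀ hNpos]
    refine (Finset.sum_le_sum fun k _ => hle k).trans_eq ?_
    rw [Finset.sum_const, Finset.card_univ, Fintype.card_fin, nsmul_eq_mul]
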